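/- For $g\ge 1$ and integers $n_0,\dots,n_g\ge 1$, let $B=B_{n_0,\dots,n_g}$ be the \emph{banana graph} of genus $g$: two vertices joined by $g+1$ internally disjoint paths (strands) of lengths $n_0,\dots,n_g$. Let $v_{\alpha,i}$ ($0\le i\le n_\alpha$) be the vertex at distance $i$ from the first of these two vertices along the $\alpha$-th strand, so that $v_{\alpha,0}$ and $v_{\alpha,n_\alpha}$ do not depend on $\alpha$. Write $r(D)$ for the Baker--Norine rank of a divisor $D$ on $B$. For two marked vertices $u,v$ put $$\Delta(D)=r(D)-r(D-u)-r(D-v)+r(D-u-v).$$ A divisor $D$ is \emph{submodular} if $\Delta(D+au+bv)\ge 0$ for all $a,b\in\mathbb Z$. A \emph{transmission permutation} of $D$ is a bijection $\tau:\mathbb Z\to\mathbb Z$ such that, for all $a,b\in\mathbb Z$, $\Delta(D+au-bv)=1$ if $\tau(b)=a$ and $\Delta(D+au-bv)=0$ otherwise. Let $k$ be the order of $[u-v]$ in the Jacobian of $B$. A \emph{$k$-inversion} of $\tau$ is a class of pairs $(a,b)$ with $a<b$ and $\tau(a)>\tau(b)$, modulo $(a,b)\sim(a+mk,b+mk)$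 for $m\in\mathbb Z$. Let $M=M(B,u,v)$ be the maximum number of $k$-inversions of $\tau$, over all transmission permutations $\tau$ of divisors on $(B,u,v)$. 1. (Quadratic growth.) There is an absolute constant $c>0$ such that for all $g\ge3$, all $n_0,\dots,n_g\ge1$ and all marked vertices $u=v_{\alpha,i}$, $v=v_{\beta,j}$ (with $\alpha=\beta$ allowed): if every divisor on $B$ is submodular with respect to $u,v$, and the marked strands satisfy $n_\alpha,n_\beta\ge g+1$, then $M$ exists and $M\ge c\,g^2$. 2. (Explicit bounds.) For all $g\ge2$ and all $n_0,\dots,n_g\ge 1$, the maximum $M$ exists in each of the following cases and satisfies the stated bound. (a) If $(u,v)=(v_{\alpha,0},v_{\alpha,n_\alpha})$, then $M\ge\binom{g+1}{2}$. (b) If $(u,v)=(v_{\alpha,0},v_{\alpha,n_\alpha-1})$ with $n_\alpha\ge2$, then $$M\ge\binom{f(g)+1}{2}+f(g)\,h+\binom{h}{2},$$ where $f(x)=\left\lfloor \frac{x}{n_\alpha-1}\right\rfloor$ and $h=f(g)(n_\alpha-2)+\min\{n_\alpha-2,\ f(n_\alpha g)-n_\alpha f(g)\}$. (c) If $(u,v)=(v_{\alpha,1},v_{\beta,n_\beta-1})$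 with $\alpha\ne\beta$ and $\min\{n_\alpha,n_\beta\}\ge g+1$, then $M\ge\binom{g-2}{2}$. -/

import Mathlib

namespace ChipFiring

noncomputable section

/-! ### Divisors on a finite multigraph -/

section Divisors

variable {V E : Type*} (G : Graph V E)

/-- The number of edges joining `x` and `y`. -/
def edgeMult (x y : G.vertexSet) : ℕ := Set.ncard {e : E | G.IsLink e x y}

/-- Divisors: integer combinations of the vertices of a finite graph. -/
abbrev Divisor : Type _ := G.vertexSet → ℤ

open Classical in
/-- The divisor consisting of one chip at `x`. -/
def point (x : G.vertexSet) : Divisor G := Pi.single x 1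

variable [Fintype G.vertexSet]

def degree (D : Divisor G) : ℤ := ∑ x, D x

/-- The effect of firing every vertex `x` exactly `f x` times: along each edge `xy`, the vertex `x`
sends `f x` chips to `y` and receives `f y` chips from `y`. -/
def fire : Divisor G →+ Divisor G where
  toFun f x := ∑ y, (edgeMult G x y : ℤ) * (f y - f x)
  map_zero' := by ext x; simp
  map_add' f f' := by
    ext x
    simp only [Pi.add_apply, ← Finset.sum_add_distrib]
    exact Finset.sum_congr rfl fun y _ => by ring

/-- The subgroup of principal divisors. -/
def principal : AddSubgroup (Divisor G) := (fire G).range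

/-- The Picard group; the Jacobian is its subgroup of classes of degree `0`. -/
abbrev Pic : Type _ := Divisor G ⧸ principal G

/-- The linear system of `D` is nonempty. -/
def IsEquivEffective (D : Divisor G) : Prop :=
  ∃ D' : Divisor G, 0 ≤ D' ∧ D - D' ∈ principal G

/-- The Baker-Norine rank: the largest integer `r ≥ -1` such that `D - F` is equivalent to an
effective divisor for each effective divisor `F` of degree `r` (no such `F` exists for
`r = -1`). -/
def rank (D : Divisor G) : ℤ :=
  sSup {r : ℤ | -1 ≤ r ∧ ∀ F : Divisor G, 0 ≤ F → degree G F = r → IsEquivEffective G (D - F)}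

/-! ### Twice-marked graphs -/

variable (u v : G.vertexSet)

/-- `Δ(D) = r(D) - r(D - u) - r(D - v) + r(D - u - v)`. -/
def delta (D : Divisor G) : ℤ :=
  rank G D - rank G (D - point G u) - rank G (D - point G v) + rank G (D - point G u - point G v)

def IsSubmodular (D : Divisor G) : Prop :=
  ∀ a b : ℤ, 0 ≤ delta G u v (D + a • point G u + b • point G v)

/-- The order of the class of `u - v`. -/
def torsionOrder : ℕ := addOrderOf (QuotientAddGroup.mk (point G u - point G v) : Pic G)

/-- `τ` is the transmission permutation of `D`. -/
def IsTransmissionPerm (D : Divisor G) (τ : Equiv.Perm ℤ) : Prop :=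
  ∀ a b : ℤ, delta G u v (D + a • point G u - b • point G v) = if τ b = a then 1 else 0

end Divisors

/-! ### Counting `k`-inversions -/

def Inversion (τ : Equiv.Perm ℤ) : Type := {p : ℤ × ℤ // p.1 < p.2 ∧ τ p.2 < τ p.1}

/-- Two inversions are `k`-equivalent if they differ by a simultaneous translation of both entries
by a multiple of `k`. -/
def inversionSetoid (k : ℕ) (τ : Equiv.Perm ℤ) : Setoid (Inversion τ) where
  r p q := p.1.1 - q.1.1 = p.1.2 - q.1.2 ∧ (k : ℤ) ∣ p.1.1 - q.1.1
  iseqv :=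
    { refl := fun p => by simp
      symm := fun {p q} h => ⟨by linarith [h.1], by
        have := (dvd_neg (a := (k : ℤ))).2 h.2
        rwa [neg_sub] at this⟩
      trans := fun {p q s} h h' => ⟨by linarith [h.1, h'.1], by
        have := dvd_add h.2 h'.2
        rwa [sub_add_sub_cancel] at this⟩ }

/-- The number of `k`-equivalence classes of inversions of `τ`. -/
def invCount (k : ℕ) (τ : Equiv.Perm ℤ) : ℕ∞ := ENat.card (Quotient (inversionSetoid k τ))

/-- `M` is the maximum number of `k`-inversions of a transmission permutation of a divisor on
`(G, u, v)`, where `k` is the torsion order. -/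
def IsMaxInversions {V E : Type*} (G : Graph V E) [Fintype G.vertexSet] (u v : G.vertexSet)
    (M : ℕ) : Prop :=
  IsGreatest {N : ℕ∞ | ∃ (D : Divisor G) (τ : Equiv.Perm ℤ),
    IsTransmissionPerm G u v D τ ∧ N = invCount (torsionOrder G u v) τ} (M : ℕ∞)

/-! ### Banana graphs -/

/-- The vertices of the banana graph: two multivalent vertices, and `n α - 1` interior vertices on
the `α`-th strand. -/
abbrev BananaVertex {g : ℕ} (n : Fin (g + 1) → ℕ) : Type :=
  Bool ⊕ (Σ α : Fin (g + 1), Fin (n α - 1))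

/-- The vertex at distance `i` from the first multivalent vertex along the `α`-th strand, for
`0 ≤ i ≤ n α`. -/
def strandVertex {g : ℕ} (n : Fin (g + 1) → ℕ) (α : Fin (g + 1)) (i : ℕ) : BananaVertex n :=
  if i = 0 then .inl false
  else if h : i - 1 < n α - 1 then .inr ⟨α, ⟨i - 1, h⟩⟩
  else .inl true

/-- The banana graph: `g + 1` paths of lengths `n 0, …, n g ≥ 1` joining two vertices. The `i`-th
edge of the `α`-th strand joins its `i`-th and `(i + 1)`-st vertices. -/
def banana {g : ℕ} (n : Fin (g + 1) → ℕ) :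
    Graph (BananaVertex n) (Σ α : Fin (g + 1), Fin (n α)) where
  vertexSet := Set.univ
  IsLink e x y := s(x, y) = s(strandVertex n e.1 e.2, strandVertex n e.1 (e.2 + 1))
  edgeSet := Set.univ
  isLink_symm e _ := ⟨fun x y h => by rw [Sym2.eq_swap]; exact h⟩
  eq_or_eq_of_isLink_of_isLink e x y v w h h' := by
    have := h.trans h'.symm
    rw [Sym2.eq_iff] at this
    tauto
  edge_mem_iff_exists_isLink e := ⟨fun _ => ⟨_, _, rfl⟩, fun _ => trivial⟩
  left_mem_of_isLink _ _ _ _ := trivial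

instance {g : ℕ} (n : Fin (g + 1) → ℕ) : Fintype (banana n).vertexSet :=
  inferInstanceAs (Fintype (Set.univ : Set (BananaVertex n)))

/-- The vertex `v_{α,i}` of the banana graph. -/
def bananaVertex {g : ℕ} (n : Fin (g + 1) → ℕ) (α : Fin (g + 1)) (i : ℕ) :
    (banana n).vertexSet :=
  ⟨strandVertex n α i, trivial⟩

end

end ChipFiring

/-! Write p, q for the multivalent vertices. Firing the interior vertices makes the classes along
strand γ an arithmetic progression, so the class of D depends only on its degree, on D(q), and on
the moments m_γ (sums of chip positions inside the strands). These are packed into one step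
function, `profile` P_D(j) = D(q) + Σ_γ ⌊(j + m_γ)/n_γ⌋, and linear equivalence only shifts j.
Spreading D so that each strand carries one chip at the remainder of j + m_γ shows that D is
equivalent to an effective divisor iff some j has P_D(j) ≥ 0 and P_D(j-1) + g + 1 ≤ deg D
(`isEquivEffective_iff`). The rank follows (`le_rank_iff`): r(D) ≥ s ≥ 0 iff deg D ≥ s + g or D -
s(p+q) is equivalent to an effective divisor. All later rank computations reduce to values of P at 0
and -1.

Second differences of the rank table of a submodular divisor form a permutation matrix
(`IsSubmodular.exists_isTransmissionPerm`). Degree considerations bound the length of inversions, so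
with finite torsion order the maximum M exists (`IsTransmissionPerm.exists_isMaxInversions`).

Quadratic growth: if the torsion order k were at most g, then ku ~ kv would force u and v to lie at
the same relative distance from p (`mul_eq_mul_of_torsionOrder_le`), and explicit divisors of small
degree would violate submodularity; hence k > g (`lt_torsionOrder`). With m = ⌊g/2⌋, the divisor
m(p+q) has rank at least m, so at least m + 1 nonnegative integers are sent to nonpositive ones and
at least g - m negative integers to positive ones. Every such pair is an inversion, and k > g keeps
the pairs inequivalent.

Explicit bounds: submodularity comes from a local criterion on profiles (`isSubmodular_of_profile`),
and the permutation of D = 0 is evaluated. In cases (a) and (c) it has a long decreasing run τ(-x) =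
x. In case (b) its values depend on the residue of the argument modulo n_α, and inversions are
counted by pairing slots (`exists_isMaxInversions_left_interior`). -/

namespace ChipFiring

/-! ### Vertices of the banana graph and firing as a sum over edges -/

section Banana

variable {g : ℕ} (n : Fin (g + 1) → ℕ)

/-- The first multivalent vertex of the banana graph. -/
def leftEnd : (banana n).vertexSet := ⟨.inl false, trivial⟩

/-- The second multivalent vertex of the banana graph. -/
def rightEnd : (banana n).vertexSet := ⟨.inl true, trivial⟩

lemma bananaVertex_zero (γ : Fin (g + 1)) : bananaVertex n γ 0 = leftEnd n :=
  Subtype.ext (by simp [bananaVertex, strandVertex, leftEnd])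

variable {n}

lemma bananaVertex_last {γ : Fin (g + 1)} (h : 1 ≤ n γ) : bananaVertex n γ (n γ) = rightEnd n := by
  apply Subtype.ext
  have : n γ ≠ 0 := by omega
  simp [bananaVertex, strandVertex, rightEnd, this]

lemma bananaVertex_interior {γ : Fin (g + 1)} (t : Fin (n γ - 1)) :
    bananaVertex n γ (t + 1) = ⟨.inr ⟨γ, t⟩, trivial⟩ := by
  apply Subtype.ext
  simp [bananaVertex, strandVertex]

lemma exists_eq_bananaVertex (hn : ∀ γ, 1 ≤ n γ) (x : (banana n).vertexSet) :
    ∃ γ t, t ≤ n γ ∧ x = bananaVertex n γ t := by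
  obtain ⟨(_ | _) | ⟨γ, t⟩, hx⟩ := x
  · exact ⟨0, 0, Nat.zero_le _, (bananaVertex_zero n 0).symm⟩
  · exact ⟨0, n 0, le_rfl, (bananaVertex_last (hn 0)).symm⟩
  · exact ⟨γ, t + 1, by have := t.2; omega, (bananaVertex_interior t).symm⟩

lemma isLink_banana_iff (e : Σ α : Fin (g + 1), Fin (n α)) (x y : (banana n).vertexSet) :
    (banana n).IsLink e x y ↔
      (x = bananaVertex n e.1 e.2 ∧ y = bananaVertex n e.1 (e.2 + 1)) ∨
      (x = bananaVertex n e.1 (e.2 + 1) ∧ y = bananaVertex n e.1 e.2) := by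
  change s(x.1, y.1) = s(_, _) ↔ _
  rw [Sym2.eq_iff]
  simp only [bananaVertex, Subtype.ext_iff]

/-- Firing, written as a sum over the edges. -/
lemma fire_banana (f : Divisor (banana n)) :
    fire (banana n) f = ∑ γ, ∑ t ∈ Finset.range (n γ),
      (f (bananaVertex n γ (t + 1)) - f (bananaVertex n γ t)) •
        (point (banana n) (bananaVertex n γ t) - point (banana n) (bananaVertex n γ (t + 1))) := by
  classical
  ext x
  have key : ∀ (e : Σ α : Fin (g + 1), Fin (n α)),
      ∑ y : (banana n).vertexSet, (if (banana n).IsLink e x y then (1 : ℤ) else 0) * (f y - f x) =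
      ((f (bananaVertex n e.1 (e.2 + 1)) - f (bananaVertex n e.1 e.2)) •
        (point (banana n) (bananaVertex n e.1 e.2)
          - point (banana n) (bananaVertex n e.1 (e.2 + 1)))) x := by
    intro e
    have : ∀ y : (banana n).vertexSet, (if (banana n).IsLink e x y then (1 : ℤ) else 0) * (f y - f x) =
        (if y = bananaVertex n e.1 (e.2 + 1) then
          (if x = bananaVertex n e.1 e.2 then f y - f x else 0) else 0) +
        (if y = bananaVertex n e.1 e.2 then
          (if x = bananaVertex n e.1 (e.2 + 1) then f y - f x else 0) else 0) := by
      intro y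
      rw [isLink_banana_iff]
      by_cases h1 : x = bananaVertex n e.1 e.2 <;> by_cases h2 : x = bananaVertex n e.1 (e.2 + 1) <;>
        by_cases h3 : y = bananaVertex n e.1 e.2 <;>
          by_cases h4 : y = bananaVertex n e.1 (e.2 + 1) <;> simp_all
    rw [Finset.sum_congr rfl fun y _ => this y, Finset.sum_add_distrib, Finset.sum_ite_eq',
      Finset.sum_ite_eq']
    simp only [Finset.mem_univ, if_true, point, Pi.smul_apply, Pi.sub_apply, Pi.single_apply,
      smul_eq_mul]
    split_ifs <;> simp_all
  have hm : ∀ y : (banana n).vertexSet, (edgeMult (banana n) x y : ℤ) =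
      ∑ e : Σ α : Fin (g + 1), Fin (n α), if (banana n).IsLink e x y then (1 : ℤ) else 0 := by
    intro y
    rw [edgeMult, Set.ncard_eq_toFinset_card']
    simp
  change ∑ y, (edgeMult (banana n) x y : ℤ) * (f y - f x) = _
  simp only [hm, Finset.sum_mul]
  rw [Finset.sum_comm, Finset.sum_congr rfl fun e _ => key e, Fintype.sum_sigma, Finset.sum_apply]
  refine Finset.sum_congr rfl fun γ _ => ?_
  rw [Finset.sum_apply, Finset.sum_range]

end Banana

/-! ### Moments, degree and the profile -/

section Coordinates

variable {g : ℕ} {n : Fin (g + 1) → ℕ}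

lemma sum_mul_point {V E : Type*} (G : Graph V E) [Fintype G.vertexSet] (h : G.vertexSet → ℤ)
    (x : G.vertexSet) : ∑ y, h y * point G x y = h x := by
  classical
  simp [point, Pi.single_apply]

lemma eq_sum_point {V E : Type*} (G : Graph V E) [Fintype G.vertexSet] (D : Divisor G) :
    D = ∑ x, D x • point G x := by
  classical
  ext y
  simp [point, Finset.sum_apply, Pi.single_apply]

/-- The distance from the first multivalent vertex, as a function on the interior of a strand,
extended by zero. -/
def position (γ : Fin (g + 1)) (x : (banana n).vertexSet) : ℤ :=
  match x.1 with
  | .inl _ => 0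
  | .inr ⟨δ, t⟩ => if δ = γ then t + 1 else 0

lemma position_nonneg (γ : Fin (g + 1)) (x : (banana n).vertexSet) : 0 ≤ position γ x := by
  obtain ⟨_ | ⟨δ, t⟩, hx⟩ := x <;> simp only [position]
  · exact le_rfl
  · split_ifs <;> positivity

lemma position_bananaVertex (γ δ : Fin (g + 1)) (t : ℕ) :
    position γ (bananaVertex n δ t) = if δ = γ ∧ t < n δ then (t : ℤ) else 0 := by
  rcases Nat.eq_zero_or_pos t with rfl | ht
  · simp [bananaVertex_zero, position, leftEnd]
  · by_cases h : t < n δ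
    · obtain ⟨s, rfl⟩ : ∃ s, t = s + 1 := ⟨t - 1, by omega⟩
      have h' : s < n δ - 1 := by omega
      have := bananaVertex_interior (n := n) (γ := δ) ⟨s, h'⟩
      simp only at this
      rw [this]
      simp [position, h]
    · have h' : ¬ t - 1 < n δ - 1 := by omega
      have h0 : t ≠ 0 := by omega
      simp [bananaVertex, strandVertex, position, h, h', h0]

/-- The sum of the positions of the chips in the interior of a strand. -/
def moment (γ : Fin (g + 1)) (D : Divisor (banana n)) : ℤ := ∑ x, position γ x * D x

lemma moment_add (γ : Fin (g + 1)) (D D' : Divisor (banana n)) :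
    moment γ (D + D') = moment γ D + moment γ D' := by
  simp [moment, mul_add, Finset.sum_add_distrib]

lemma moment_sub (γ : Fin (g + 1)) (D D' : Divisor (banana n)) :
    moment γ (D - D') = moment γ D - moment γ D' := by
  simp [moment, mul_sub, Finset.sum_sub_distrib]

lemma moment_smul (γ : Fin (g + 1)) (a : ℤ) (D : Divisor (banana n)) :
    moment γ (a • D) = a * moment γ D := by
  simp only [moment, Finset.mul_sum, Pi.smul_apply, smul_eq_mul]
  exact Finset.sum_congr rfl fun x _ => by ring

lemma moment_sum {ι : Type*} (s : Finset ι) (γ : Fin (g + 1)) (D : ι → Divisor (banana n)) :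
    moment γ (∑ i ∈ s, D i) = ∑ i ∈ s, moment γ (D i) := by
  simp only [moment, Finset.sum_apply, Finset.mul_sum]
  exact Finset.sum_comm

lemma moment_point (γ : Fin (g + 1)) (x : (banana n).vertexSet) :
    moment γ (point (banana n) x) = position γ x := sum_mul_point _ _ _

lemma position_leftEnd (γ : Fin (g + 1)) : position γ (leftEnd n) = 0 := rfl

lemma position_rightEnd (γ : Fin (g + 1)) : position γ (rightEnd n) = 0 := rfl

lemma degree_add {V E : Type*} (G : Graph V E) [Fintype G.vertexSet] (D D' : Divisor G) :
    degree G (D + D') = degree G D + degree G D' := by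
  simp [degree, Finset.sum_add_distrib]

lemma degree_sub {V E : Type*} (G : Graph V E) [Fintype G.vertexSet] (D D' : Divisor G) :
    degree G (D - D') = degree G D - degree G D' := by
  simp [degree, Finset.sum_sub_distrib]

lemma degree_smul {V E : Type*} (G : Graph V E) [Fintype G.vertexSet] (a : ℤ) (D : Divisor G) :
    degree G (a • D) = a * degree G D := by
  simp [degree, Finset.mul_sum]

lemma degree_sum {V E ι : Type*} (G : Graph V E) [Fintype G.vertexSet] (s : Finset ι)
    (D : ι → Divisor G) : degree G (∑ i ∈ s, D i) = ∑ i ∈ s, degree G (D i) := by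
  simp only [degree, Finset.sum_apply]
  exact Finset.sum_comm

lemma degree_point {V E : Type*} (G : Graph V E) [Fintype G.vertexSet] (x : G.vertexSet) :
    degree G (point G x) = 1 := by
  have := sum_mul_point G (fun _ => 1) x
  simpa [degree] using this

lemma degree_nonneg {V E : Type*} (G : Graph V E) [Fintype G.vertexSet] {D : Divisor G}
    (h : 0 ≤ D) : 0 ≤ degree G D := Finset.sum_nonneg fun x _ => h x

lemma point_nonneg {V E : Type*} (G : Graph V E) (x : G.vertexSet) : 0 ≤ point G x := by
  classical
  intro y
  simp only [point, Pi.single_apply, Pi.zero_apply]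
  split_ifs <;> simp

lemma point_apply_rightEnd (hn : ∀ γ, 1 ≤ n γ) (γ : Fin (g + 1)) {t : ℕ} (ht : t ≤ n γ) :
    point (banana n) (bananaVertex n γ t) (rightEnd n) = if t = n γ then 1 else 0 := by
  classical
  by_cases h : t = n γ
  · rw [h, bananaVertex_last (hn γ)]
    simp [point]
  · rw [if_neg h]
    have hne : rightEnd n ≠ bananaVertex n γ t := by
      intro he
      have := congrArg Subtype.val he
      simp only [bananaVertex, strandVertex, rightEnd] at this
      split_ifs at this with h1 h2
      · simp at this
      · omega
    simp [point, hne]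

lemma point_leftEnd_apply_rightEnd : point (banana n) (leftEnd n) (rightEnd n) = 0 := by
  classical
  have hne : rightEnd n ≠ leftEnd n := by
    intro he
    have := congrArg Subtype.val he
    simp [leftEnd, rightEnd] at this
  simp [point, hne]

lemma point_rightEnd_apply_rightEnd : point (banana n) (rightEnd n) (rightEnd n) = 1 := by
  classical
  simp [point]

lemma degree_fire (f : Divisor (banana n)) : degree (banana n) (fire (banana n) f) = 0 := by
  rw [fire_banana]
  simp only [degree_sum, degree_smul, degree_sub, degree_point, sub_self, mul_zero,
    Finset.sum_const_zero]

lemma fire_apply_rightEnd (hn : ∀ γ, 1 ≤ n γ) (f : Divisor (banana n)) :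
    fire (banana n) f (rightEnd n) =
      ∑ γ, (f (bananaVertex n γ (n γ - 1)) - f (rightEnd n)) := by
  rw [fire_banana]
  simp only [Finset.sum_apply, Pi.smul_apply, Pi.sub_apply, smul_eq_mul]
  refine Finset.sum_congr rfl fun γ _ => ?_
  have h1 := hn γ
  rw [Finset.sum_eq_single (n γ - 1)]
  · rw [point_apply_rightEnd hn γ (by omega), point_apply_rightEnd hn γ (by omega),
      Nat.sub_add_cancel h1, if_neg (by omega), if_pos rfl, bananaVertex_last h1]
    ring
  · intro t ht htn
    rw [Finset.mem_range] at ht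
    rw [point_apply_rightEnd hn γ (by omega), point_apply_rightEnd hn γ (by omega),
      if_neg (by omega), if_neg (by omega)]
    ring
  · intro h
    exact absurd (Finset.mem_range.2 (by omega)) h

/-- Summation by parts along the strand: every edge but the last contributes a telescoping term. The
last one is exceptional because `position` is 0, not n_γ, at the second end, which produces the
multiple of n_γ. -/
lemma moment_fire (hn : ∀ γ, 1 ≤ n γ) (γ : Fin (g + 1)) (f : Divisor (banana n)) :
    moment γ (fire (banana n) f) = f (leftEnd n) - f (rightEnd n)
      + n γ * (f (rightEnd n) - f (bananaVertex n γ (n γ - 1))) := by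
  rw [fire_banana]
  simp only [moment_sum, moment_smul, moment_sub, moment_point, position_bananaVertex]
  rw [Finset.sum_eq_single γ]
  · obtain ⟨N, hN⟩ : ∃ N, n γ = N + 1 := ⟨n γ - 1, by have := hn γ; omega⟩
    rw [hN, Finset.sum_range_succ]
    have : ∀ t ∈ Finset.range N, (f (bananaVertex n γ (t + 1)) - f (bananaVertex n γ t)) *
        ((if γ = γ ∧ t < N + 1 then (t : ℤ) else 0) -
          if γ = γ ∧ t + 1 < N + 1 then ((t + 1 : ℕ) : ℤ) else 0) =
        f (bananaVertex n γ t) - f (bananaVertex n γ (t + 1)) := by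
      intro t ht
      rw [Finset.mem_range] at ht
      rw [if_pos ⟨rfl, by omega⟩, if_pos ⟨rfl, by omega⟩]
      push_cast
      ring
    rw [Finset.sum_congr rfl this, Finset.sum_range_sub', bananaVertex_zero]
    have h2 := bananaVertex_last (hn γ)
    rw [hN] at h2
    rw [h2]
    simp
    ring
  · intro δ _ hδ
    exact Finset.sum_eq_zero fun t _ => by simp [hδ]
  · simp

/-- The profile of a divisor, which determines its linear equivalence class up to a translation of
the argument once the degree is known. -/
def profile (D : Divisor (banana n)) (j : ℤ) : ℤ :=
  D (rightEnd n) + ∑ γ, (j + moment γ D) / n γ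

/-- The multiple of n_γ in `moment_fire` leaves the floor as an integer and cancels the change of
the coefficient at the second end; only the common shift of the argument survives. -/
lemma profile_add_fire (hn : ∀ γ, 1 ≤ n γ) (D f : Divisor (banana n)) (j : ℤ) :
    profile (D + fire (banana n) f) j = profile D (j + (f (leftEnd n) - f (rightEnd n))) := by
  simp only [profile, moment_add, moment_fire hn, Pi.add_apply, fire_apply_rightEnd hn]
  rw [add_assoc, ← Finset.sum_add_distrib]
  congr 1
  refine Finset.sum_congr rfl fun γ _ => ?_
  have : (n γ : ℤ) ≠ 0 := by have := hn γ; omega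
  rw [show j + (moment γ D + (f (leftEnd n) - f (rightEnd n) +
      n γ * (f (rightEnd n) - f (bananaVertex n γ (n γ - 1))))) =
      (j + (f (leftEnd n) - f (rightEnd n)) + moment γ D) +
      n γ * (f (rightEnd n) - f (bananaVertex n γ (n γ - 1))) by ring,
    Int.add_mul_ediv_left _ _ this]
  ring

lemma profile_mono (hn : ∀ γ, 1 ≤ n γ) (D : Divisor (banana n)) : Monotone (profile D) := by
  intro i j hij
  refine add_le_add le_rfl (Finset.sum_le_sum fun γ _ => ?_)
  exact Int.ediv_le_ediv (by have := hn γ; omega) (by linarith)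

end Coordinates

/-! ### The Picard group and the criterion for effectivity -/

noncomputable section Effective

variable {g : ℕ} {n : Fin (g + 1) → ℕ}

variable (n) in
/-- The class of a vertex in the Picard group. -/
def vertexClass (γ : Fin (g + 1)) (t : ℕ) : Pic (banana n) :=
  QuotientAddGroup.mk (point (banana n) (bananaVertex n γ t))

variable (n) in
/-- The difference of the classes of two consecutive vertices of a strand. -/
def slope (γ : Fin (g + 1)) : Pic (banana n) := vertexClass n γ 1 - vertexClass n γ 0

lemma sum_vertexClass_eq_zero (f : Divisor (banana n)) :
    ∑ γ, ∑ t ∈ Finset.range (n γ),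
      (f (bananaVertex n γ (t + 1)) - f (bananaVertex n γ t)) •
        (vertexClass n γ t - vertexClass n γ (t + 1)) = 0 := by
  have h : (QuotientAddGroup.mk' (principal (banana n))) (fire (banana n) f) = 0 :=
    (QuotientAddGroup.eq_zero_iff _).2 ⟨f, rfl⟩
  rw [fire_banana] at h
  simp only [map_sum, map_zsmul, map_sub] at h
  exact h

/-- The relation obtained by firing a single interior vertex, which `position` singles out because
its value there is positive. -/
lemma vertexClass_add_two {γ : Fin (g + 1)} {t : ℕ} (ht : t + 1 < n γ) :
    vertexClass n γ (t + 2) - vertexClass n γ (t + 1) =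
      vertexClass n γ (t + 1) - vertexClass n γ t := by
  classical
  have h := sum_vertexClass_eq_zero (n := n) fun x => if position γ x = (t + 1 : ℕ) then 1 else 0
  have hf : ∀ (δ : Fin (g + 1)) (s : ℕ), (if position γ (bananaVertex n δ s) = (t + 1 : ℕ)
      then (1 : ℤ) else 0) = if δ = γ ∧ s = t + 1 then 1 else 0 := by
    intro δ s
    rw [position_bananaVertex]
    congr 1
    by_cases h1 : δ = γ
    · subst h1
      by_cases h2 : s < n δ
      · simp only [h2, and_self, if_true, true_and, eq_iff_iff]
        omega
      · simp only [h2, and_false, if_false, true_and, eq_iff_iff]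
        omega
    · simp only [h1, false_and, if_false, eq_iff_iff, iff_false]
      omega
  simp only [hf] at h
  rw [Finset.sum_eq_single γ] at h
  · simp only [true_and, add_left_inj, sub_smul, Finset.sum_sub_distrib, ite_smul, one_smul,
      zero_smul] at h
    rw [Finset.sum_ite_eq', Finset.sum_ite_eq', if_pos (Finset.mem_range.2 (by omega)),
      if_pos (Finset.mem_range.2 ht)] at h
    rw [sub_eq_zero] at h
    rw [← neg_sub (vertexClass n γ t), h, neg_sub]
  · intro δ _ hδ
    simp [hδ]
  · simp

lemma vertexClass_zero (γ : Fin (g + 1)) :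
    vertexClass n γ 0 = QuotientAddGroup.mk (point (banana n) (leftEnd n)) := by
  rw [vertexClass, bananaVertex_zero]

lemma vertexClass_succ (γ : Fin (g + 1)) {t : ℕ} (ht : t + 1 ≤ n γ) :
    vertexClass n γ (t + 1) = vertexClass n γ t + slope n γ := by
  induction t with
  | zero => simp [slope]
  | succ t ih =>
    have h := vertexClass_add_two (n := n) (γ := γ) (t := t) (by omega)
    rw [sub_eq_iff_eq_add'] at h
    rw [h, ih (by omega)]
    abel

/-- Along a strand, the classes of the vertices form an arithmetic progression. -/
lemma vertexClass_eq (γ : Fin (g + 1)) {t : ℕ} (ht : t ≤ n γ) :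
    vertexClass n γ t =
      QuotientAddGroup.mk (point (banana n) (leftEnd n)) + (t : ℤ) • slope n γ := by
  induction t with
  | zero => simp [vertexClass_zero]
  | succ t ih =>
    rw [vertexClass_succ γ ht, ih (by omega)]
    push_cast
    rw [add_zsmul, one_zsmul, add_assoc]

lemma smul_slope (hn : ∀ γ, 1 ≤ n γ) (γ : Fin (g + 1)) :
    (n γ : ℤ) • slope n γ = QuotientAddGroup.mk (point (banana n) (rightEnd n)) -
      QuotientAddGroup.mk (point (banana n) (leftEnd n)) := by
  rw [eq_sub_iff_add_eq', ← vertexClass_eq γ le_rfl, vertexClass, bananaVertex_last (hn γ)]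

/-- The relation obtained by firing the first multivalent vertex alone. -/
lemma sum_slope (hn : ∀ γ, 1 ≤ n γ) : ∑ γ, slope n γ = 0 := by
  classical
  have h := sum_vertexClass_eq_zero (n := n) fun x => if x = leftEnd n then 1 else 0
  have hf : ∀ (δ : Fin (g + 1)) (s : ℕ), (if bananaVertex n δ s = leftEnd n
      then (1 : ℤ) else 0) = if s = 0 then 1 else 0 := by
    intro δ s
    congr 1
    rw [eq_iff_iff]
    constructor
    · intro he
      have := congrArg Subtype.val he
      simp only [bananaVertex, strandVertex, leftEnd] at this
      split_ifs at this with h1 h2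
      · exact h1
      · simp at this
    · rintro rfl
      exact bananaVertex_zero n δ
  simp only [hf] at h
  rw [← h]
  refine Finset.sum_congr rfl fun γ _ => ?_
  rw [Finset.sum_eq_single 0]
  · simp [slope]
  · intro t _ ht
    simp [ht]
  · intro h0
    exact absurd (Finset.mem_range.2 (hn γ)) h0

lemma sum_smul_add_smul_add_sum {A X Γ : Type*} [AddCommGroup A] [Fintype X] [Fintype Γ]
    (D r : X → ℤ) (m : Γ → X → ℤ) (P E : A) (s : Γ → A) :
    ∑ x, D x • (P + r x • E + ∑ γ, m γ x • s γ) =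
      (∑ x, D x) • P + (∑ x, D x * r x) • E + ∑ γ, (∑ x, m γ x * D x) • s γ := by
  simp only [smul_add, Finset.sum_add_distrib, Finset.sum_smul, Finset.smul_sum, smul_smul]
  congr 1
  rw [Finset.sum_comm]
  simp only [mul_comm]

/-- The class of a divisor in terms of its degree and its moments. -/
lemma mk_eq (hn : ∀ γ, 1 ≤ n γ) (D : Divisor (banana n)) :
    (QuotientAddGroup.mk D : Pic (banana n)) =
      degree (banana n) D • QuotientAddGroup.mk (point (banana n) (leftEnd n)) +
      D (rightEnd n) • (QuotientAddGroup.mk (point (banana n) (rightEnd n)) -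
        QuotientAddGroup.mk (point (banana n) (leftEnd n))) +
      ∑ γ, moment γ D • slope n γ := by
  set P : Pic (banana n) := QuotientAddGroup.mk (point (banana n) (leftEnd n))
  set Q : Pic (banana n) := QuotientAddGroup.mk (point (banana n) (rightEnd n))
  have hpt : ∀ x, (QuotientAddGroup.mk (point (banana n) x) : Pic (banana n)) =
      P + point (banana n) x (rightEnd n) • (Q - P) + ∑ γ, position γ x • slope n γ := by
    intro x
    obtain ⟨γ, t, ht, rfl⟩ := exists_eq_bananaVertex hn x
    have h1 := vertexClass_eq γ ht
    rw [vertexClass] at h1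
    rw [h1, point_apply_rightEnd hn γ ht]
    rcases ht.lt_or_eq with h | rfl
    · rw [if_neg h.ne, Finset.sum_eq_single γ]
      · simp [position_bananaVertex, h, P]
      · intro δ _ hδ
        simp [position_bananaVertex, hδ.symm]
      · simp
    · rw [smul_slope hn, if_pos rfl, Finset.sum_eq_zero]
      · simp [P, Q]
      · intro δ _
        simp [position_bananaVertex]
  let π := QuotientAddGroup.mk' (principal (banana n))
  have hD : (QuotientAddGroup.mk D : Pic (banana n)) =
      ∑ x, D x • (QuotientAddGroup.mk (point (banana n) x) : Pic (banana n)) := by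
    conv_lhs => rw [eq_sum_point (banana n) D]
    change π _ = ∑ x, D x • π _
    rw [map_sum]
    simp only [map_zsmul]
  have hr : D (rightEnd n) = ∑ x, D x * point (banana n) x (rightEnd n) := by
    classical
    simp [point, Pi.single_apply]
  rw [hD, hr]
  simp only [hpt]
  exact sum_smul_add_smul_add_sum D _ _ P (Q - P) _

lemma profile_nonneg_of_nonneg {D : Divisor (banana n)} (hD : 0 ≤ D) : 0 ≤ profile D 0 := by
  refine add_nonneg (hD _) (Finset.sum_nonneg fun γ _ => ?_)
  refine Int.ediv_nonneg ?_ (by positivity)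
  rw [zero_add]
  exact Finset.sum_nonneg fun x _ => mul_nonneg (position_nonneg γ x) (hD x)

/-- The numbers of chips in the interiors of the strands control the moments. -/
lemma exists_moment_le (hn : ∀ γ, 1 ≤ n γ) {D : Divisor (banana n)} (hD : 0 ≤ D) :
    ∃ N : Fin (g + 1) → ℤ, (∀ γ, moment γ D ≤ n γ * N γ) ∧
      D (rightEnd n) + ∑ γ, N γ ≤ degree (banana n) D := by
  classical
  refine ⟨fun γ => ∑ x, (if position γ x = 0 then 0 else 1) * D x, fun γ => ?_, ?_⟩
  · simp only [moment, Finset.mul_sum]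
    refine Finset.sum_le_sum fun x _ => ?_
    obtain ⟨δ, t, ht, rfl⟩ := exists_eq_bananaVertex hn x
    rw [← mul_assoc]
    refine mul_le_mul_of_nonneg_right ?_ (hD _)
    rw [position_bananaVertex]
    by_cases h : δ = γ ∧ t < n δ
    · obtain ⟨rfl, h⟩ := h
      simp only [h, and_self, if_true]
      split_ifs with h0
      · omega
      · omega
    · simp [h]
  · have h1 : D (rightEnd n) = ∑ x, point (banana n) (rightEnd n) x * D x := by
      simp [point, Pi.single_apply]
    rw [h1, Finset.sum_comm, ← Finset.sum_add_distrib]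
    refine Finset.sum_le_sum fun x _ => ?_
    rw [← Finset.sum_mul, ← add_mul]
    refine mul_le_of_le_one_left (hD x) ?_
    obtain ⟨(_ | _) | ⟨γ, t⟩, hx⟩ := x
    · simp only [position, if_true, Finset.sum_const_zero, add_zero, point, Pi.single_apply]
      split_ifs <;> simp
    · simp [position, point, rightEnd]
    · rw [Finset.sum_eq_single γ]
      · have hne : (⟨.inr ⟨γ, t⟩, hx⟩ : (banana n).vertexSet) ≠ rightEnd n := fun he => by
          have := congrArg Subtype.val he
          simp [rightEnd] at this
        simp only [point, Pi.single_apply, hne, if_false]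
        split_ifs <;> simp
      · intro δ _ hδ
        simp [position, hδ.symm]
      · simp

lemma moment_nonneg (γ : Fin (g + 1)) {D : Divisor (banana n)} (hD : 0 ≤ D) : 0 ≤ moment γ D :=
  Finset.sum_nonneg fun x _ => mul_nonneg (position_nonneg γ x) (hD x)

/-- N chips inside strand γ have moment at most n_γ N, so ⌊(m_γ - 1)/n_γ⌋ + 1 ≤ N. Summing over the
g + 1 strands bounds the profile by the number of chips away from the first end. -/
lemma profile_neg_one_le_of_nonneg (hn : ∀ γ, 1 ≤ n γ) {D : Divisor (banana n)} (hD : 0 ≤ D) :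
    profile D (-1) + g + 1 ≤ degree (banana n) D := by
  obtain ⟨N, hN, hdeg⟩ := exists_moment_le hn hD
  have hsum : ∑ γ, ((-1 + moment γ D) / (n γ : ℤ) + 1) ≤ ∑ γ, N γ := by
    refine Finset.sum_le_sum fun γ _ => ?_
    have hpos : (0 : ℤ) < n γ := by have := hn γ; omega
    have : (-1 + moment γ D) / n γ < N γ := by
      rw [Int.ediv_lt_iff_lt_mul hpos]
      linarith [mul_comm (N γ) (n γ), hN γ]
    omega
  rw [Finset.sum_add_distrib] at hsum
  simp only [Finset.sum_const, Finset.card_univ, Fintype.card_fin, nsmul_eq_mul, mul_one] at hsum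
  simp only [profile]
  push_cast at hsum
  linarith

lemma add_smul_eq {A : Type*} [AddCommGroup A] (P s : A) {t m j e N : ℤ} (h : t + N * e = j + m) :
    P + t • s = P + m • s + j • s - e • (N • s) := by
  obtain rfl : t = j + m - N * e := by linarith
  module

lemma add_sum_smul_eq {A Γ : Type*} [AddCommGroup A] [Fintype Γ] {s : Γ → A} (hs : ∑ γ, s γ = 0)
    (P Q : A) (m e : Γ → ℤ) {d c a Y j : ℤ} (hd : a + Y + Finset.univ.card (α := Γ) = d)
    (hc : Y - ∑ γ, e γ = c) :
    d • P + c • (Q - P) + ∑ γ, m γ • s γ =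
      a • P + Y • Q + ∑ γ, (P + m γ • s γ + j • s γ - e γ • (Q - P)) := by
  simp only [Finset.sum_sub_distrib, Finset.sum_add_distrib, ← Finset.smul_sum, hs, smul_zero,
    Finset.sum_const, ← Finset.sum_smul, ← hd, ← hc]
  module

/-- A divisor on a banana graph is equivalent to an effective one exactly when its profile crosses
zero with a large enough jump. -/
theorem isEquivEffective_iff (hn : ∀ γ, 1 ≤ n γ) (D : Divisor (banana n)) :
    IsEquivEffective (banana n) D ↔
      ∃ j, 0 ≤ profile D j ∧ profile D (j - 1) + g + 1 ≤ degree (banana n) D := by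
  classical
  constructor
  · rintro ⟨D', hD', f, hf⟩
    have hD : D = D' + fire (banana n) f := by rw [hf]; abel
    refine ⟨-(f (leftEnd n) - f (rightEnd n)), ?_, ?_⟩
    · rw [hD, profile_add_fire hn, neg_add_cancel]
      exact profile_nonneg_of_nonneg hD'
    · rw [hD, profile_add_fire hn, degree_add, degree_fire, add_zero]
      rw [show -(f (leftEnd n) - f (rightEnd n)) - 1 + (f (leftEnd n) - f (rightEnd n)) = -1 by ring]
      exact profile_neg_one_le_of_nonneg hn hD'
  · rintro ⟨j, h0, h1⟩
    have hpos : ∀ γ, (0 : ℤ) < n γ := fun γ => by have := hn γ; omega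
    let t : Fin (g + 1) → ℕ := fun γ => ((j + moment γ D) % n γ).toNat
    have ht : ∀ γ, (t γ : ℤ) = (j + moment γ D) % n γ := fun γ =>
      Int.toNat_of_nonneg (Int.emod_nonneg _ (hpos γ).ne')
    have htn : ∀ γ, t γ < n γ := fun γ => by
      have := Int.emod_lt_of_pos (j + moment γ D) (hpos γ)
      rw [← ht] at this
      exact_mod_cast this
    -- The candidate representative: one chip on each strand at the remainder of j + m_γ, P(j) chips
    -- at the second end, and the rest of the degree at the first end.
    set a : ℤ := degree (banana n) D - profile D j - (g + 1)
    let D' : Divisor (banana n) := a • point (banana n) (leftEnd n) +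
      profile D j • point (banana n) (rightEnd n) +
      ∑ γ, point (banana n) (bananaVertex n γ (t γ))
    -- From j - 1 to j a floor increases exactly on strands with remainder 0, where the strand chip
    -- sits at the first end. These chips compensate a possibly negative `a`, which is why the
    -- criterion involves P(j-1).
    have hprev : ∀ γ, (j + moment γ D) / n γ - (if t γ = 0 then 1 else 0) =
        (j - 1 + moment γ D) / n γ := by
      intro γ
      symm
      rw [Int.ediv_eq_iff_of_pos (hpos γ)]
      have h2 := Int.emod_add_mul_ediv (j + moment γ D) (n γ)
      have h3 := htn γ
      rw [← ht] at h2
      have h3' := hpos γ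
      split_ifs with h
      · rw [h] at h2
        constructor <;> push_cast at h2 <;> nlinarith
      · have : 1 ≤ t γ := by omega
        constructor <;> nlinarith
    refine ⟨D', fun x => ?_, ?_⟩
    · have hs : 0 ≤ ∑ γ, point (banana n) (bananaVertex n γ (t γ)) :=
        Finset.sum_nonneg fun γ _ => point_nonneg _ _
      by_cases hx : x = leftEnd n
      · subst hx
        have h2 : point (banana n) (rightEnd n) (leftEnd n) = 0 := by
          have : leftEnd n ≠ rightEnd n := by
            intro he
            have := congrArg Subtype.val he
            simp [leftEnd, rightEnd] at this
          simp [point, this]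
        have h3 : ∑ γ, (if t γ = 0 then (1 : ℤ) else 0) ≤
            ∑ γ, point (banana n) (bananaVertex n γ (t γ)) (leftEnd n) := by
          refine Finset.sum_le_sum fun γ _ => ?_
          split_ifs with h
          · rw [h, bananaVertex_zero]
            simp [point]
          · exact point_nonneg _ _ _
        have h4 : profile D (j - 1) = profile D j - ∑ γ, (if t γ = 0 then (1 : ℤ) else 0) := by
          simp only [profile, ← hprev, Finset.sum_sub_distrib]
          ring
        simp only [D', Pi.add_apply, Pi.smul_apply, smul_eq_mul, h2, Finset.sum_apply,
          Pi.zero_apply]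
        have h5 : point (banana n) (leftEnd n) (leftEnd n) = 1 := by simp [point]
        rw [h5]
        linarith
      · have h2 : point (banana n) (leftEnd n) x = 0 := by simp [point, hx]
        simp only [D', Pi.add_apply, Pi.smul_apply, smul_eq_mul, h2, mul_zero, zero_add,
          Pi.zero_apply]
        exact add_nonneg (mul_nonneg h0 (point_nonneg _ _ _)) (hs x)
    · rw [← QuotientAddGroup.eq_zero_iff]
      let π := QuotientAddGroup.mk' (principal (banana n))
      change π (D - D') = 0
      rw [map_sub, sub_eq_zero]
      simp only [D', map_add, map_zsmul, map_sum]
      have h2 : ∀ γ, π (point (banana n) (bananaVertex n γ (t γ))) =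
          π (point (banana n) (leftEnd n)) + (moment γ D) • slope n γ + j • slope n γ -
            ((j + moment γ D) / n γ) •
              (π (point (banana n) (rightEnd n)) - π (point (banana n) (leftEnd n))) := by
        intro γ
        have h3 := vertexClass_eq γ (htn γ).le
        have h4 := smul_slope hn γ
        change π _ = π _ + _ at h3
        change _ = π _ - π _ at h4
        rw [h3, ← h4]
        refine add_smul_eq _ _ ?_
        have := Int.emod_add_mul_ediv (j + moment γ D) (n γ)
        rw [ht]
        linarith
      simp only [h2]
      change (QuotientAddGroup.mk D : Pic (banana n)) = _
      rw [mk_eq hn]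
      refine add_sum_smul_eq (sum_slope hn) (π (point (banana n) (leftEnd n)))
        (π (point (banana n) (rightEnd n))) (fun γ => moment γ D)
        (fun γ => (j + moment γ D) / n γ) ?_ ?_
      · simp only [a, Finset.card_univ, Fintype.card_fin]
        push_cast
        ring
      · simp only [profile]
        ring

end Effective

/-! ### The rank formula -/

noncomputable section Rank

variable {g : ℕ} {n : Fin (g + 1) → ℕ}

lemma profile_sub_le (hn : ∀ γ, 1 ≤ n γ) (D : Divisor (banana n)) {F : Divisor (banana n)}
    (hF : 0 ≤ F) (j : ℤ) : profile (D - F) j ≤ profile D j := by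
  refine add_le_add (sub_le_self _ (hF _)) (Finset.sum_le_sum fun γ _ => ?_)
  refine Int.ediv_le_ediv (by have := hn γ; omega) ?_
  rw [moment_sub]
  linarith [moment_nonneg γ hF]

/-- Each removed chip lowers the profile by at most one: a chip at the second end by exactly one, an
interior chip by shifting one floor's argument by less than n_γ. -/
lemma le_profile_sub (hn : ∀ γ, 1 ≤ n γ) (D : Divisor (banana n)) {F : Divisor (banana n)}
    (hF : 0 ≤ F) (j : ℤ) : profile D j - degree (banana n) F ≤ profile (D - F) j := by
  obtain ⟨N, hN, hdeg⟩ := exists_moment_le hn hF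
  have : ∑ γ, ((j + moment γ D) / (n γ : ℤ) - N γ) ≤ ∑ γ, (j + moment γ (D - F)) / (n γ : ℤ) := by
    refine Finset.sum_le_sum fun γ _ => ?_
    have hpos : (0 : ℤ) < n γ := by have := hn γ; omega
    rw [moment_sub, sub_eq_add_neg (_ / _), ← Int.add_mul_ediv_right _ _ hpos.ne']
    refine Int.ediv_le_ediv hpos ?_
    linarith [hN γ, mul_comm (N γ) (n γ)]
  simp only [profile, Pi.sub_apply]
  rw [Finset.sum_sub_distrib] at this
  linarith

lemma profile_le_profile_sub_one (hn : ∀ γ, 1 ≤ n γ) (D : Divisor (banana n)) (j : ℤ) :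
    profile D j ≤ profile D (j - 1) + g + 1 := by
  have : ∑ γ, (j + moment γ D) / (n γ : ℤ) ≤ ∑ γ, ((j - 1 + moment γ D) / (n γ : ℤ) + 1) := by
    refine Finset.sum_le_sum fun γ _ => ?_
    have hpos : (1 : ℤ) ≤ n γ := by have := hn γ; omega
    rw [show (j - 1 + moment γ D) / (n γ : ℤ) + 1 = (j - 1 + moment γ D + 1 * n γ) / (n γ : ℤ) by
      rw [Int.add_mul_ediv_right _ _ (by omega)]]
    exact Int.ediv_le_ediv (by omega) (by linarith)
  rw [Finset.sum_add_distrib] at this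
  simp only [Finset.sum_const, Finset.card_univ, Fintype.card_fin, nsmul_eq_mul, mul_one] at this
  simp only [profile]
  push_cast at this
  linarith

lemma exists_profile_crossing (hn : ∀ γ, 1 ≤ n γ) (D : Divisor (banana n)) :
    ∃ j, 0 ≤ profile D j ∧ profile D (j - 1) < 0 := by
  set K : ℤ := |D (rightEnd n)| + 1
  set B : ℤ := ∑ γ, (|moment γ D| + n γ * K)
  have hK : 0 < K := by positivity
  have hB : ∀ γ, |moment γ D| + n γ * K ≤ B := fun γ =>
    Finset.single_le_sum (f := fun γ => |moment γ D| + n γ * K) (fun γ _ => by positivity)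
      (Finset.mem_univ γ)
  have hpos : ∀ γ, (0 : ℤ) < n γ := fun γ => by have := hn γ; omega
  have hup : 0 ≤ profile D B := by
    have : ∑ _γ : Fin (g + 1), K ≤ ∑ γ, (B + moment γ D) / (n γ : ℤ) := by
      refine Finset.sum_le_sum fun γ _ => ?_
      rw [Int.le_ediv_iff_mul_le (hpos γ)]
      linarith [hB γ, neg_abs_le (moment γ D), mul_comm K (n γ)]
    simp only [Finset.sum_const, Finset.card_univ, Fintype.card_fin, nsmul_eq_mul] at this
    push_cast at this
    have h2 : (0 : ℤ) ≤ g * K := by positivity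
    simp only [profile]
    linarith [neg_abs_le (D (rightEnd n))]
  have hdown : profile D (-B) < 0 := by
    have : ∑ γ, (-B + moment γ D) / (n γ : ℤ) ≤ ∑ _γ : Fin (g + 1), -K := by
      refine Finset.sum_le_sum fun γ _ => ?_
      refine (Int.ediv_le_ediv (b := -K * n γ) (hpos γ) ?_).trans_eq
        (Int.mul_ediv_cancel _ (hpos γ).ne')
      linarith [hB γ, le_abs_self (moment γ D), mul_comm K (n γ)]
    simp only [Finset.sum_const, Finset.card_univ, Fintype.card_fin, nsmul_eq_mul] at this
    push_cast at this
    have h2 : (0 : ℤ) ≤ g * K := by positivity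
    simp only [profile]
    linarith [le_abs_self (D (rightEnd n))]
  obtain ⟨j, hj, hmin⟩ := Int.exists_least_of_bdd (P := fun j => 0 ≤ profile D j)
    ⟨-B, fun z hz => by
      by_contra h
      exact absurd (profile_mono hn D (not_le.1 h).le) (by linarith)⟩ ⟨B, hup⟩
  refine ⟨j, hj, ?_⟩
  by_contra h
  have := hmin (j - 1) (not_lt.1 h)
  omega

/-- Where the profile crosses zero, P(j-1) ≤ -1, so the second inequality of the criterion costs
only degree g. -/
lemma isEquivEffective_of_le_degree (hn : ∀ γ, 1 ≤ n γ) {D : Divisor (banana n)}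
    (hD : g ≤ degree (banana n) D) : IsEquivEffective (banana n) D := by
  obtain ⟨j, h0, h1⟩ := exists_profile_crossing hn D
  exact (isEquivEffective_iff hn D).2 ⟨j, h0, by omega⟩

/-- The set of which the rank is the supremum. -/
def rankSet (D : Divisor (banana n)) : Set ℤ :=
  {r | -1 ≤ r ∧ ∀ F : Divisor (banana n), 0 ≤ F → degree (banana n) F = r →
    IsEquivEffective (banana n) (D - F)}

/-- The profile criterion for `D - s (p + q)` to be equivalent to an effective divisor, where `p`
and `q` are the multivalent vertices; `p + q` is the hyperelliptic pencil of the banana graph. -/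
def HasJump (D : Divisor (banana n)) (s : ℤ) : Prop :=
  ∃ j, s ≤ profile D j ∧ profile D (j - 1) + g + 1 + s ≤ degree (banana n) D

lemma HasJump.two_mul_le (hn : ∀ γ, 1 ≤ n γ) {D : Divisor (banana n)} {s : ℤ}
    (h : HasJump D s) : 2 * s ≤ degree (banana n) D := by
  obtain ⟨j, h0, h1⟩ := h
  linarith [profile_le_profile_sub_one hn D j]

lemma profile_sub_ends (D : Divisor (banana n)) (x y j : ℤ) :
    profile (D - (x • point (banana n) (leftEnd n) + y • point (banana n) (rightEnd n))) j =
      profile D j - y := by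
  simp only [profile, moment_sub, moment_add, moment_smul, moment_point, position_leftEnd,
    position_rightEnd, Pi.sub_apply, Pi.add_apply, Pi.smul_apply, smul_eq_mul,
    point_leftEnd_apply_rightEnd, point_rightEnd_apply_rightEnd]
  ring_nf

/-- It suffices to test effective divisors supported on the two multivalent vertices. For the
converse, `le_profile_sub` and `profile_sub_le` show that a jump of size s survives the removal of
any s chips. -/
lemma mem_rankSet_iff (hn : ∀ γ, 1 ≤ n γ) (D : Divisor (banana n)) {s : ℤ} (hs : 0 ≤ s) :
    s ∈ rankSet D ↔ s + g ≤ degree (banana n) D ∨ HasJump D s := by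
  constructor
  · rintro ⟨-, h⟩
    by_contra! hcon
    obtain ⟨hd, hJ⟩ := hcon
    have key : ∀ y : ℤ, 0 ≤ y → y ≤ s →
        ∃ j, y ≤ profile D j ∧ profile D (j - 1) - y + g + 1 ≤ degree (banana n) D - s := by
      intro y hy hys
      have hE := h ((s - y) • point (banana n) (leftEnd n) + y • point (banana n) (rightEnd n))
        (add_nonneg (smul_nonneg (by omega) (point_nonneg _ _)) (smul_nonneg hy (point_nonneg _ _)))
        (by simp only [degree_add, degree_smul, degree_point]; ring)
      obtain ⟨j, h0, h1⟩ := (isEquivEffective_iff hn _).1 hE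
      rw [profile_sub_ends] at h0 h1
      rw [degree_sub, degree_add, degree_smul, degree_smul, degree_point, degree_point] at h1
      exact ⟨j, by linarith, by linarith⟩
    obtain ⟨j, hj0, hj1⟩ := key 0 le_rfl hs
    -- One index j serves every y. If it failed first at y + 1, the index i for y + 1 would exceed
    -- j, so P(i-1) ≥ P(j) ≥ y, while the criterion at i and deg D < s + g give P(i-1) < y.
    have hall : ∀ y : ℕ, (y : ℤ) ≤ s → (y : ℤ) ≤ profile D j := by
      intro y
      induction y with
      | zero => intro _; exact_mod_cast hj0
      | succ y ih =>
        intro hy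
        push_cast at hy ⊢
        have ih' := ih (by omega)
        obtain ⟨i, hi0, hi1⟩ := key (y + 1) (by omega) hy
        by_contra hlt
        have hij : j < i := by
          by_contra hij
          have := profile_mono hn D (not_lt.1 hij)
          omega
        have := profile_mono hn D (show j ≤ i - 1 by omega)
        omega
    refine hJ ⟨j, ?_, by linarith⟩
    have := hall s.toNat (by omega)
    omega
  · intro h
    refine ⟨by omega, fun F hF hdeg => ?_⟩
    rcases h with h | ⟨j, h0, h1⟩
    · refine isEquivEffective_of_le_degree hn ?_
      rw [degree_sub]
      omega
    · refine (isEquivEffective_iff hn _).2 ⟨j, ?_, ?_⟩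
      · have := le_profile_sub hn D hF j
        omega
      · have := profile_sub_le hn D hF (j - 1)
        rw [degree_sub]
        omega

lemma neg_one_mem_rankSet (D : Divisor (banana n)) : -1 ∈ rankSet D := by
  refine ⟨le_rfl, fun F hF hdeg => ?_⟩
  have := degree_nonneg _ hF
  omega

lemma bddAbove_rankSet (hn : ∀ γ, 1 ≤ n γ) (D : Divisor (banana n)) : BddAbove (rankSet D) := by
  refine ⟨max 0 (degree (banana n) D), fun s hs => ?_⟩
  by_contra hlt
  rcases max_lt_iff.1 (not_le.1 hlt) with ⟨h0, h1⟩
  rcases (mem_rankSet_iff hn D h0.le).1 hs with h | h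
  · omega
  · have := h.two_mul_le hn
    omega

lemma rank_mem_rankSet (hn : ∀ γ, 1 ≤ n γ) (D : Divisor (banana n)) :
    rank (banana n) D ∈ rankSet D :=
  Int.csSup_mem ⟨-1, neg_one_mem_rankSet D⟩ (bddAbove_rankSet hn D)

lemma le_rank_of_mem (hn : ∀ γ, 1 ≤ n γ) {D : Divisor (banana n)} {s : ℤ} (h : s ∈ rankSet D) :
    s ≤ rank (banana n) D :=
  le_csSup (bddAbove_rankSet hn D) h

lemma neg_one_le_rank (hn : ∀ γ, 1 ≤ n γ) (D : Divisor (banana n)) : -1 ≤ rank (banana n) D :=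
  (rank_mem_rankSet hn D).1

/-- The rank of a divisor on a banana graph in terms of its profile. -/
theorem le_rank_iff (hn : ∀ γ, 1 ≤ n γ) (D : Divisor (banana n)) {s : ℤ} (hs : 0 ≤ s) :
    s ≤ rank (banana n) D ↔ s + g ≤ degree (banana n) D ∨ HasJump D s := by
  constructor
  · intro h
    rcases (mem_rankSet_iff hn D (hs.trans h)).1 (rank_mem_rankSet hn D) with h' | ⟨j, h0, h1⟩
    · exact Or.inl (by omega)
    · exact Or.inr ⟨j, by omega, by omega⟩
  · exact fun h => le_rank_of_mem hn ((mem_rankSet_iff hn D hs).2 h)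

lemma rank_of_degree_neg (hn : ∀ γ, 1 ≤ n γ) {D : Divisor (banana n)}
    (h : degree (banana n) D < 0) : rank (banana n) D = -1 := by
  refine le_antisymm ?_ (neg_one_le_rank hn D)
  by_contra hlt
  rcases (le_rank_iff hn D le_rfl).1 (show 0 ≤ rank (banana n) D by omega) with h' | h'
  · omega
  · have := h'.two_mul_le hn
    omega

lemma degree_sub_le_rank (hn : ∀ γ, 1 ≤ n γ) (D : Divisor (banana n)) :
    degree (banana n) D - g ≤ rank (banana n) D := by
  by_cases h : 0 ≤ degree (banana n) D - g
  · exact (le_rank_iff hn D h).2 (Or.inl (by omega))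
  · have := neg_one_le_rank hn D
    omega

/-- A jump of size s needs 2s ≤ deg D, which fails for s = deg D - g + 1 once deg D ≥ 2g. -/
lemma rank_of_le_degree (hn : ∀ γ, 1 ≤ n γ) {D : Divisor (banana n)}
    (h : 2 * g ≤ degree (banana n) D) : rank (banana n) D = degree (banana n) D - g := by
  refine le_antisymm ?_ (degree_sub_le_rank hn D)
  by_contra hlt
  rcases (le_rank_iff hn D (s := degree (banana n) D - g + 1) (by omega)).1 (by omega) with h' | h'
  · omega
  · have := h'.two_mul_le hn
    omega

lemma rank_sub_point_le (hn : ∀ γ, 1 ≤ n γ) (D : Divisor (banana n)) (x : (banana n).vertexSet) :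
    rank (banana n) (D - point (banana n) x) ≤ rank (banana n) D := by
  obtain ⟨h1, h2⟩ := rank_mem_rankSet hn (D - point (banana n) x)
  refine le_rank_of_mem hn ⟨h1, fun F hF hdeg => ?_⟩
  obtain ⟨D', h0, h⟩ := h2 F hF hdeg
  refine ⟨D' + point (banana n) x, add_nonneg h0 (point_nonneg _ _), ?_⟩
  rwa [show D - F - (D' + point (banana n) x) = D - point (banana n) x - F - D' by abel]

lemma rank_sub_one_le (hn : ∀ γ, 1 ≤ n γ) (D : Divisor (banana n)) (x : (banana n).vertexSet) :
    rank (banana n) D - 1 ≤ rank (banana n) (D - point (banana n) x) := by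
  obtain ⟨h1, h2⟩ := rank_mem_rankSet hn D
  rcases h1.eq_or_lt with h | h
  · rw [← h]
    linarith [neg_one_le_rank hn (D - point (banana n) x)]
  refine le_rank_of_mem hn ⟨by omega, fun F hF hdeg => ?_⟩
  rw [show D - point (banana n) x - F = D - (F + point (banana n) x) by abel]
  refine h2 _ (add_nonneg hF (point_nonneg _ _)) ?_
  rw [degree_add, degree_point]
  omega

end Rank

/-! ### Transmission permutations from rank tables -/

noncomputable section Transmission

variable {g : ℕ} {n : Fin (g + 1) → ℕ}

lemma rank_congr {V E : Type*} (G : Graph V E) [Fintype G.vertexSet] {D D' : Divisor G}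
    (h : D - D' ∈ principal G) : rank G D = rank G D' := by
  have key : ∀ F : Divisor G, IsEquivEffective G (D - F) ↔ IsEquivEffective G (D' - F) := by
    intro F
    refine exists_congr fun D'' => and_congr_right fun _ => ?_
    rw [show D - F - D'' = (D - D') + (D' - F - D'') by abel]
    exact (principal G).add_mem_cancel_left h
  simp only [rank, key]

lemma delta_congr {V E : Type*} (G : Graph V E) [Fintype G.vertexSet] (u v : G.vertexSet)
    {D D' : Divisor G} (h : D - D' ∈ principal G) : delta G u v D = delta G u v D' := by
  simp only [delta]
  congr 1
  · congr 1
    · congr 1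
      · exact rank_congr G h
      · exact rank_congr G (by rwa [sub_sub_sub_cancel_right])
    · exact rank_congr G (by rwa [sub_sub_sub_cancel_right])
  · exact rank_congr G (by rwa [sub_sub_sub_cancel_right, sub_sub_sub_cancel_right])

lemma smul_sub_mem_principal_iff {V E : Type*} (G : Graph V E) [Fintype G.vertexSet]
    (u v : G.vertexSet) (z : ℤ) :
    z • (point G u - point G v) ∈ principal G ↔ (torsionOrder G u v : ℤ) ∣ z := by
  rw [torsionOrder, addOrderOf_dvd_iff_zsmul_eq_zero, ← QuotientAddGroup.eq_zero_iff]
  rfl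

/-- Transmission permutations commute with translation by multiples of the torsion order. -/
lemma IsTransmissionPerm.apply_add {V E : Type*} {G : Graph V E} [Fintype G.vertexSet]
    {u v : G.vertexSet} {D : Divisor G} {τ : Equiv.Perm ℤ} (hτ : IsTransmissionPerm G u v D τ)
    {z : ℤ} (hz : (torsionOrder G u v : ℤ) ∣ z) (b : ℤ) : τ (b + z) = τ b + z := by
  have h1 := hτ (τ b) b
  have h2 := hτ (τ b + z) (b + z)
  rw [if_pos rfl] at h1
  rw [delta_congr G u v (D' := D + τ b • point G u - b • point G v), h1] at h2
  · by_contra h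
    rw [if_neg h] at h2
    exact one_ne_zero h2
  · convert (smul_sub_mem_principal_iff G u v z).2 hz using 1
    simp only [add_smul, smul_sub]
    abel

/-- A nondecreasing 0/1-valued function that takes both values steps exactly once; this places a
single 1 in each row and each column of the table of Δ. -/
lemma exists_step {F : ℤ → ℤ} (h0 : ∀ a, 0 ≤ F a) (h1 : ∀ a, F a ≤ 1)
    (hF : ∀ a, F (a - 1) ≤ F a) {lo hi : ℤ} (hlo : ∀ a ≤ lo, F a = 0) (hhi : F hi = 1) :
    ∃ t, ∀ a, F a - F (a - 1) = if t = a then 1 else 0 := by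
  have hmono : Monotone F := monotone_int_of_le_succ fun a => by simpa using hF (a + 1)
  obtain ⟨t, ht, hmin⟩ := Int.exists_least_of_bdd (P := fun a => F a = 1)
    ⟨lo, fun z hz => by
      by_contra h
      have := hlo z (by omega)
      omega⟩ ⟨hi, hhi⟩
  have hlt : ∀ a < t, F a = 0 := fun a ha => by
    have := h0 a
    have := h1 a
    by_contra h
    have := hmin a (by omega)
    omega
  have hge : ∀ a ≥ t, F a = 1 := fun a ha => by
    have := h1 a
    have := hmono ha
    omega
  refine ⟨t, fun a => ?_⟩
  split_ifs with h
  · subst h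
    rw [ht, hlt _ (by omega)]
    rfl
  · rcases lt_or_gt_of_ne h with h | h
    · rw [hge _ (by omega), hge _ (by omega)]
      rfl
    · rw [hlt _ (by omega), hlt _ (by omega)]
      rfl

variable {u v : (banana n).vertexSet}

lemma delta_of_degree_neg (hn : ∀ γ, 1 ≤ n γ) {D : Divisor (banana n)}
    (h : degree (banana n) D < 0) : delta (banana n) u v D = 0 := by
  simp only [delta]
  rw [rank_of_degree_neg hn h, rank_of_degree_neg hn, rank_of_degree_neg hn, rank_of_degree_neg hn]
  · rfl
  all_goals simp only [degree_sub, degree_point]; omega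

lemma delta_of_lt_degree (hn : ∀ γ, 1 ≤ n γ) {D : Divisor (banana n)}
    (h : 2 * g + 1 < degree (banana n) D) : delta (banana n) u v D = 0 := by
  simp only [delta]
  rw [rank_of_le_degree hn (by omega), rank_of_le_degree hn, rank_of_le_degree hn,
    rank_of_le_degree hn]
  all_goals simp only [degree_sub, degree_point]; omega

lemma degree_add_smul_sub_smul (D : Divisor (banana n)) (a b : ℤ) :
    degree (banana n) (D + a • point (banana n) u - b • point (banana n) v) =
      degree (banana n) D + a - b := by
  simp only [degree_add, degree_sub, degree_smul, degree_point, mul_one]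

lemma IsTransmissionPerm.degree_bounds (hn : ∀ γ, 1 ≤ n γ) {D : Divisor (banana n)}
    {τ : Equiv.Perm ℤ} (hτ : IsTransmissionPerm (banana n) u v D τ) (b : ℤ) :
    0 ≤ degree (banana n) D + τ b - b ∧ degree (banana n) D + τ b - b ≤ 2 * g + 1 := by
  have h := hτ (τ b) b
  rw [if_pos rfl] at h
  rw [← degree_add_smul_sub_smul (u := u) (v := v)]
  constructor
  · by_contra hlt
    rw [delta_of_degree_neg hn (not_le.1 hlt)] at h
    exact zero_ne_one h
  · by_contra hlt
    rw [delta_of_lt_degree hn (not_le.1 hlt)] at h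
    exact zero_ne_one h

/-- Submodular divisors have transmission permutations. -/
theorem IsSubmodular.exists_isTransmissionPerm (hn : ∀ γ, 1 ≤ n γ) {D : Divisor (banana n)}
    (hD : IsSubmodular (banana n) u v D) :
    ∃ τ, IsTransmissionPerm (banana n) u v D τ := by
  set R : ℤ → ℤ → ℤ := fun a b =>
    rank (banana n) (D + a • point (banana n) u - b • point (banana n) v) with hR
  have hRu : ∀ a b, R (a - 1) b =
      rank (banana n) (D + a • point (banana n) u - b • point (banana n) v - point (banana n) u) :=
    fun a b => by
      simp only [hR, sub_smul, one_smul]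
      congr 1
      abel
  have hRv : ∀ a b, R a (b + 1) =
      rank (banana n) (D + a • point (banana n) u - b • point (banana n) v - point (banana n) v) :=
    fun a b => by
      simp only [hR, add_smul, one_smul]
      congr 1
      abel
  have hΔ : ∀ a b, delta (banana n) u v (D + a • point (banana n) u - b • point (banana n) v) =
      R a b - R (a - 1) b - R a (b + 1) + R (a - 1) (b + 1) := by
    intro a b
    rw [hRu, hRv, delta]
    congr 1
    simp only [hR, sub_smul, add_smul, one_smul]
    congr 1
    abel
  have hpos : ∀ a b, 0 ≤ R a b - R (a - 1) b - R a (b + 1) + R (a - 1) (b + 1) := by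
    intro a b
    rw [← hΔ]
    have := hD a (-b)
    rwa [neg_smul, ← sub_eq_add_neg] at this
  have hlow : ∀ a b, degree (banana n) D + a - b < 0 → R a b = -1 := fun a b h =>
    rank_of_degree_neg hn (by rwa [degree_add_smul_sub_smul])
  have hhigh : ∀ a b, 2 * g ≤ degree (banana n) D + a - b → R a b = degree (banana n) D + a - b - g :=
    fun a b h => by
      rw [← degree_add_smul_sub_smul (u := u) (v := v)] at h ⊢
      exact rank_of_le_degree hn h
  have hu0 : ∀ a b, 0 ≤ R a b - R (a - 1) b := fun a b => by
    rw [hRu]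
    exact sub_nonneg.2 (rank_sub_point_le hn _ _)
  have hu1 : ∀ a b, R a b - R (a - 1) b ≤ 1 := fun a b => by
    rw [hRu]
    linarith [rank_sub_one_le hn (D + a • point (banana n) u - b • point (banana n) v) u]
  have hv0 : ∀ a b, 0 ≤ R a b - R a (b + 1) := fun a b => by
    rw [hRv]
    exact sub_nonneg.2 (rank_sub_point_le hn _ _)
  have hv1 : ∀ a b, R a b - R a (b + 1) ≤ 1 := fun a b => by
    rw [hRv]
    linarith [rank_sub_one_le hn (D + a • point (banana n) u - b • point (banana n) v) v]
  have hcol : ∀ b, ∃ t, ∀ a, (R a b - R a (b + 1)) - (R (a - 1) b - R (a - 1) (b + 1)) =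
      if t = a then 1 else 0 := by
    intro b
    refine exists_step (F := fun a => R a b - R a (b + 1)) (fun a => hv0 a b) (fun a => hv1 a b)
      (fun a => by linarith [hpos a b]) (lo := b - degree (banana n) D - 1)
      (hi := b + 1 + 2 * g - degree (banana n) D) (fun a ha => ?_) ?_
    · rw [hlow a b (by omega), hlow a (b + 1) (by omega)]
      rfl
    · rw [hhigh _ b (by omega), hhigh _ (b + 1) (by omega)]
      ring
  -- The variable b is negated so that the row differences become nondecreasing and `exists_step`
  -- applies.
  have hrow : ∀ a, ∃ t, ∀ b, (R a (-b) - R (a - 1) (-b)) -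
      (R a (-(b - 1)) - R (a - 1) (-(b - 1))) = if t = b then 1 else 0 := by
    intro a
    refine exists_step (F := fun b => R a (-b) - R (a - 1) (-b)) (fun b => hu0 a _)
      (fun b => hu1 a _) (fun b => ?_) (lo := - degree (banana n) D - a - 1)
      (hi := 1 + 2 * g - degree (banana n) D - a) (fun b hb => ?_) ?_
    · have := hpos a (-b)
      rw [show -(b - 1) = -b + 1 by ring]
      linarith
    · rw [hlow a _ (by omega), hlow _ _ (by omega)]
      rfl
    · rw [hhigh _ _ (by omega), hhigh _ _ (by omega)]
      ring
  choose τ hτ using hcol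
  choose ρ hρ using hrow
  -- The row and column maps locate the same 1s of one table, hence are mutually inverse up to the
  -- sign change.
  have hτρ : ∀ a b, τ b = a ↔ -ρ a = b := by
    intro a b
    have h1 := hτ b a
    have h2 := hρ a (-b)
    rw [neg_neg, show -(-b - 1) = b + 1 by ring] at h2
    have h3 : (if τ b = a then (1 : ℤ) else 0) = if ρ a = -b then 1 else 0 := by
      rw [← h1, ← h2]
      ring
    rw [neg_eq_iff_eq_neg]
    by_cases h4 : τ b = a <;> by_cases h5 : ρ a = -b <;> simp_all
  refine ⟨⟨τ, fun a => -ρ a, fun b => (hτρ _ _).1 rfl, fun a => (hτρ _ _).2 rfl⟩, fun a b => ?_⟩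
  rw [hΔ]
  have := hτ b a
  simp only [Equiv.coe_fn_mk]
  rw [← this]
  ring

/-- The rank is determined by the transmission permutation. -/
lemma IsTransmissionPerm.rank_sub_rank (hn : ∀ γ, 1 ≤ n γ) {D : Divisor (banana n)}
    {τ : Equiv.Perm ℤ} (hτ : IsTransmissionPerm (banana n) u v D τ) (b : ℤ) (a : ℤ) :
    rank (banana n) (D + a • point (banana n) u - b • point (banana n) v) -
      rank (banana n) (D + a • point (banana n) u - (b + 1) • point (banana n) v) =
      if τ b ≤ a then 1 else 0 := by
  set F : ℤ → ℤ := fun a =>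
    rank (banana n) (D + a • point (banana n) u - b • point (banana n) v) -
      rank (banana n) (D + a • point (banana n) u - (b + 1) • point (banana n) v) with hF
  have hstep : ∀ a, F a - F (a - 1) = if τ b = a then 1 else 0 := by
    intro a
    rw [← hτ a b, delta]
    simp only [hF]
    rw [show D + (a - 1) • point (banana n) u - b • point (banana n) v =
        D + a • point (banana n) u - b • point (banana n) v - point (banana n) u by
          simp only [sub_smul, one_smul]; abel,
      show D + a • point (banana n) u - (b + 1) • point (banana n) v =
        D + a • point (banana n) u - b • point (banana n) v - point (banana n) v by
          simp only [add_smul, one_smul]; abel,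
      show D + (a - 1) • point (banana n) u - (b + 1) • point (banana n) v =
        D + a • point (banana n) u - b • point (banana n) v - point (banana n) u
          - point (banana n) v by
          simp only [sub_smul, add_smul, one_smul]; abel]
    ring
  have hlow : ∀ a ≤ b - degree (banana n) D - 1, F a = 0 := by
    intro a ha
    simp only [hF]
    rw [rank_of_degree_neg hn, rank_of_degree_neg hn]
    · rfl
    all_goals rw [degree_add_smul_sub_smul]; omega
  have hb := (hτ.degree_bounds hn b).1
  change F a = _
  rcases le_total a (b - degree (banana n) D - 1) with ha | ha
  · rw [hlow a ha, if_neg (by omega)]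
  · induction a, ha using Int.leInduction with
    | base => rw [hlow _ le_rfl, if_neg (by omega)]
    | succ a ha ih =>
      have h := hstep (a + 1)
      rw [add_sub_cancel_right, ih, sub_eq_iff_eq_add] at h
      rw [h]
      split_ifs <;> omega

end Transmission

lemma sum_zsmul_eq {A ι : Type*} [AddCommGroup A] (s : Finset ι) (m : ι → ℤ) (x : A) :
    (∑ i ∈ s, m i) • x = ∑ i ∈ s, m i • x := Finset.sum_smul

lemma zsmul_sum_eq {A ι : Type*} [AddCommGroup A] (s : Finset ι) (m : ℤ) (x : ι → A) :
    m • ∑ i ∈ s, x i = ∑ i ∈ s, m • x i := Finset.smul_sum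

/-! ### Finiteness and existence of the maximum -/

noncomputable section Inversions

variable {g : ℕ} {n : Fin (g + 1) → ℕ} {u v : (banana n).vertexSet}

/-- The class E = [q] - [p] equals n_γ times each slope, and the slopes sum to zero, so Σ_γ ∏_{δ≠γ}
n_δ annihilates E. Hence every slope is torsion, and u - v is a combination of slopes. -/
lemma torsionOrder_pos (hn : ∀ γ, 1 ≤ n γ) (u v : (banana n).vertexSet) :
    0 < torsionOrder (banana n) u v := by
  have hE : IsOfFinAddOrder ((QuotientAddGroup.mk (point (banana n) (rightEnd n)) -
      QuotientAddGroup.mk (point (banana n) (leftEnd n)) : Pic (banana n))) := by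
    rw [isOfFinAddOrder_iff_zsmul_eq_zero]
    refine ⟨∑ γ, ∏ δ ∈ Finset.univ.erase γ, (n δ : ℤ), ?_, ?_⟩
    · refine (Finset.sum_pos (fun γ _ => Finset.prod_pos fun δ _ => ?_)
        Finset.univ_nonempty).ne'
      have := hn δ
      omega
    · have h : ∀ γ, (∏ δ ∈ Finset.univ.erase γ, (n δ : ℤ)) •
          (QuotientAddGroup.mk (point (banana n) (rightEnd n)) -
          QuotientAddGroup.mk (point (banana n) (leftEnd n)) : Pic (banana n)) =
          (∏ δ, (n δ : ℤ)) • slope n γ := by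
        intro γ
        rw [← smul_slope hn γ, ← mul_zsmul', mul_comm, Finset.prod_erase_mul _ _ (Finset.mem_univ γ)]
      rw [sum_zsmul_eq, Finset.sum_congr rfl fun γ _ => h γ, ← zsmul_sum_eq, sum_slope hn, zsmul_zero]
  have hs : ∀ γ, IsOfFinAddOrder (slope n γ) := by
    intro γ
    rw [← smul_slope hn γ] at hE
    rw [isOfFinAddOrder_iff_zsmul_eq_zero] at hE ⊢
    obtain ⟨m, hm, h⟩ := hE
    refine ⟨m * n γ, mul_ne_zero hm (by have := hn γ; omega), ?_⟩
    rw [mul_zsmul, h]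
  rw [torsionOrder, addOrderOf_pos_iff]
  obtain ⟨γ, t, ht, rfl⟩ := exists_eq_bananaVertex hn u
  obtain ⟨δ, s, hs', rfl⟩ := exists_eq_bananaVertex hn v
  have h1 : (QuotientAddGroup.mk (point (banana n) (bananaVertex n γ t) -
      point (banana n) (bananaVertex n δ s)) : Pic (banana n)) =
      (t : ℤ) • slope n γ + -((s : ℤ) • slope n δ) := by
    change vertexClass n γ t - vertexClass n δ s = _
    rw [vertexClass_eq γ ht, vertexClass_eq δ hs']
    abel
  rw [h1]
  exact ((hs γ).zsmul).add ((hs δ).zsmul).neg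

/-- A class is determined by the residue of its first entry modulo k and by the difference of its
entries. -/
lemma invCount_le {k C : ℕ} (hk : 0 < k) {τ : Equiv.Perm ℤ}
    (h : ∀ a b, a < b → τ b < τ a → b - a < C) : invCount k τ ≤ (k * C : ℕ) := by
  have hk' : (k : ℤ) ≠ 0 := by omega
  let φ : Quotient (inversionSetoid k τ) →
      (Finset.Ico (0 : ℤ) k ×ˢ Finset.Ico (0 : ℤ) C : Finset (ℤ × ℤ)) :=
    Quotient.lift (fun p : Inversion τ => ⟨(p.1.1 % k, p.1.2 - p.1.1), by
      have h1 := h _ _ p.2.1 p.2.2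
      have h2 := p.2.1
      have h3 := Int.emod_nonneg p.1.1 hk'
      have h4 := Int.emod_lt_of_pos p.1.1 (show (0 : ℤ) < k by omega)
      simp only [Finset.mem_product, Finset.mem_Ico]
      omega⟩) (by
        rintro p q ⟨h1, h2⟩
        ext
        · exact (Int.emod_eq_emod_iff_emod_sub_eq_zero.2 (Int.emod_eq_zero_of_dvd h2))
        · simp only
          linarith)
  have hφ : Function.Injective φ := by
    intro x y
    induction x using Quotient.inductionOn with | _ p => ?_
    induction y using Quotient.inductionOn with | _ q => ?_
    intro hpq
    have h1 : p.1.1 % k = q.1.1 % k := congrArg (fun x => x.1.1) hpq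
    have h2 : p.1.2 - p.1.1 = q.1.2 - q.1.1 := congrArg (fun x => x.1.2) hpq
    refine Quotient.sound ⟨by linarith, ?_⟩
    exact Int.dvd_of_emod_eq_zero (Int.emod_eq_emod_iff_emod_sub_eq_zero.1 h1)
  refine (ENat.card_le_card_of_injective hφ).trans ?_
  rw [ENat.card_eq_coe_fintype_card]
  simp

/-- A family of pairwise inequivalent inversions bounds the number of classes from below. -/
lemma card_le_invCount {ι : Type*} {k : ℕ} {τ : Equiv.Perm ℤ} (I : Finset ι) (x y : ι → ℤ)
    (hI : ∀ i ∈ I, x i < y i ∧ τ (y i) < τ (x i))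
    (hk : ∀ i ∈ I, ∀ j ∈ I, x i - x j = y i - y j → (k : ℤ) ∣ x i - x j → i = j) :
    (I.card : ℕ∞) ≤ invCount k τ := by
  let φ : I → Quotient (inversionSetoid k τ) := fun i => Quotient.mk _ ⟨(x i, y i), hI i i.2⟩
  have hφ : Function.Injective φ := by
    intro i j hij
    obtain ⟨h1, h2⟩ := Quotient.exact hij
    exact Subtype.ext (hk i i.2 j j.2 h1 h2)
  have := ENat.card_le_card_of_injective hφ
  rw [ENat.card_eq_coe_fintype_card, Fintype.card_coe] at this
  exact this

/-- The maximum number of inversions exists as soon as there is a transmission permutation. -/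
theorem IsTransmissionPerm.exists_isMaxInversions (hn : ∀ γ, 1 ≤ n γ) {D : Divisor (banana n)}
    {τ : Equiv.Perm ℤ} (hτ : IsTransmissionPerm (banana n) u v D τ) {N : ℕ}
    (hN : (N : ℕ∞) ≤ invCount (torsionOrder (banana n) u v) τ) :
    ∃ M : ℕ, IsMaxInversions (banana n) u v M ∧ N ≤ M := by
  set k := torsionOrder (banana n) u v
  have hbound : ∀ (D : Divisor (banana n)) (τ : Equiv.Perm ℤ),
      IsTransmissionPerm (banana n) u v D τ → invCount k τ ≤ (k * (2 * g + 2) : ℕ) := by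
    intro D τ hτ
    refine invCount_le (torsionOrder_pos hn u v) fun a b _ hba => ?_
    have h1 := hτ.degree_bounds hn a
    have h2 := hτ.degree_bounds hn b
    push_cast
    omega
  set S : Set ℕ := {m | ∃ (D : Divisor (banana n)) (τ : Equiv.Perm ℤ),
    IsTransmissionPerm (banana n) u v D τ ∧ (m : ℕ∞) = invCount k τ}
  have hS : ∀ (D : Divisor (banana n)) (τ : Equiv.Perm ℤ),
      IsTransmissionPerm (banana n) u v D τ → ∃ m ∈ S, (m : ℕ∞) = invCount k τ := by
    intro D τ hτ
    obtain ⟨m, hm⟩ := ENat.ne_top_iff_exists.1 ((hbound D τ hτ).trans_lt (ENat.natCast_lt_top _)).ne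
    exact ⟨m, ⟨D, τ, hτ, hm⟩, hm⟩
  have hbdd : BddAbove S := ⟨k * (2 * g + 2), by
    rintro m ⟨D, τ, hτ, hm⟩
    have := hbound D τ hτ
    rw [← hm] at this
    exact_mod_cast this⟩
  obtain ⟨m₀, hm₀, hm₀τ⟩ := hS D τ hτ
  refine ⟨sSup S, ⟨Nat.sSup_mem ⟨m₀, hm₀⟩ hbdd, ?_⟩, ?_⟩
  · rintro _ ⟨D', τ', hτ', rfl⟩
    obtain ⟨m, hm, hmτ⟩ := hS D' τ' hτ'
    rw [← hmτ]
    exact_mod_cast le_csSup hbdd hm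
  · rw [← hm₀τ] at hN
    exact (by exact_mod_cast hN : N ≤ m₀).trans (le_csSup hbdd hm₀)

end Inversions

/-! ### A local criterion for submodularity -/

noncomputable section Submodular

variable {g : ℕ} {n : Fin (g + 1) → ℕ} {u v : (banana n).vertexSet}

lemma profile_sub_leftEnd (D : Divisor (banana n)) (j : ℤ) :
    profile (D - point (banana n) (leftEnd n)) j = profile D j := by
  simpa using profile_sub_ends D 1 0 j

lemma profile_sub_rightEnd (D : Divisor (banana n)) (j : ℤ) :
    profile (D - point (banana n) (rightEnd n)) j = profile D j - 1 := by
  simpa using profile_sub_ends D 0 1 j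

lemma moment_sub_interior {α : Fin (g + 1)} {t : ℕ} (ht : t < n α) (D : Divisor (banana n))
    (γ : Fin (g + 1)) : moment γ (D - point (banana n) (bananaVertex n α t)) =
      moment γ D - if γ = α then (t : ℤ) else 0 := by
  rw [moment_sub, moment_point, position_bananaVertex]
  by_cases h : γ = α
  · subst h
    simp [ht]
  · rw [if_neg h, if_neg fun h' => h h'.1.symm]

lemma sub_interior_apply_rightEnd (hn : ∀ γ, 1 ≤ n γ) {α : Fin (g + 1)} {t : ℕ} (ht : t < n α)
    (D : Divisor (banana n)) :
    (D - point (banana n) (bananaVertex n α t)) (rightEnd n) = D (rightEnd n) := by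
  rw [Pi.sub_apply, point_apply_rightEnd hn α ht.le, if_neg ht.ne, sub_zero]

lemma profile_sub_interior (hn : ∀ γ, 1 ≤ n γ) {α : Fin (g + 1)} {t : ℕ} (ht : t < n α)
    (D : Divisor (banana n)) (j : ℤ) :
    profile (D - point (banana n) (bananaVertex n α t)) j =
      profile D j - ((j + moment α D) / n α - (j + moment α D - t) / n α) := by
  have h : ∀ γ, (j + moment γ (D - point (banana n) (bananaVertex n α t))) / (n γ : ℤ) =
      (j + moment γ D) / (n γ : ℤ) -
        if γ = α then (j + moment α D) / n α - (j + moment α D - t) / n α else 0 := by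
    intro γ
    rw [moment_sub_interior ht]
    by_cases h : γ = α
    · subst h
      simp [add_sub_assoc]
    · simp [h]
  simp only [profile, sub_interior_apply_rightEnd hn ht, h, Finset.sum_sub_distrib]
  rw [Finset.sum_ite_eq' Finset.univ α, if_pos (Finset.mem_univ _)]
  ring

/-- If the drops of the profile caused by removing `u` and `v` are independent, and neither two
consecutive drops for `u` nor two consecutive non-drops for `v` occur, then every divisor is
submodular. -/
theorem isSubmodular_of_profile (hn : ∀ γ, 1 ≤ n γ)
    (hu : ∀ (D : Divisor (banana n)) j, profile D j - profile (D - point (banana n) u) j +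
      (profile D (j - 1) - profile (D - point (banana n) u) (j - 1)) ≤ 1)
    (hv : ∀ (D : Divisor (banana n)) j, 1 ≤ profile D j - profile (D - point (banana n) v) j +
      (profile D (j - 1) - profile (D - point (banana n) v) (j - 1)))
    (huv : ∀ (D : Divisor (banana n)) j, profile (D - point (banana n) u - point (banana n) v) j =
      profile (D - point (banana n) u) j + profile (D - point (banana n) v) j - profile D j)
    (D : Divisor (banana n)) : IsSubmodular (banana n) u v D := by
  intro a b
  generalize D + a • point (banana n) u + b • point (banana n) v = D
  set Du := D - point (banana n) u with hDu
  set Dv := D - point (banana n) v with hDv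
  set Duv := D - point (banana n) u - point (banana n) v with hDuv
  have eDuv : Duv = Dv - point (banana n) u := by
    rw [hDuv, hDv, sub_right_comm]
  have r1 := rank_sub_point_le hn D u
  have r2 := rank_sub_point_le hn D v
  have r3 := rank_sub_one_le hn D u
  have r4 := rank_sub_one_le hn D v
  have r5 := rank_sub_one_le hn Du v
  have r6 := rank_sub_one_le hn Dv u
  have r7 := rank_sub_point_le hn Du v
  have r8 := rank_sub_point_le hn Dv u
  have r9 := neg_one_le_rank hn Duv
  rw [← eDuv] at r6 r8
  rw [← hDu] at r1 r3
  rw [← hDv] at r2 r4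
  rw [← hDuv] at r5 r7
  simp only [delta]
  rw [← hDu, ← hDv, ← hDuv]
  -- Removing one chip lowers the rank by at most one, so Δ < 0 leaves a single pattern: ranks r, r,
  -- r for D, D-u, D-v and r - 1 for D-u-v. As deg D ≤ r + g, the middle two ranks must come from
  -- jumps.
  by_contra hneg
  set r := rank (banana n) D with hr
  have e1 : rank (banana n) Du = r := by omega
  have e2 : rank (banana n) Dv = r := by omega
  have e3 : rank (banana n) Duv = r - 1 := by omega
  have hr0 : 0 ≤ r := by omega
  have du : degree (banana n) Du = degree (banana n) D - 1 := by rw [degree_sub, degree_point]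
  have dv : degree (banana n) Dv = degree (banana n) D - 1 := by rw [degree_sub, degree_point]
  have duv : degree (banana n) Duv = degree (banana n) D - 2 := by
    rw [degree_sub, degree_sub, degree_point, degree_point]
    ring
  have hD := (le_rank_iff hn D (s := r + 1) (by omega)).not.1 (by omega)
  have hDu' := (le_rank_iff hn Du hr0).1 e1.ge
  have hDv' := (le_rank_iff hn Dv hr0).1 e2.ge
  have hDuv' := (le_rank_iff hn Duv hr0).not.1 (by omega)
  push Not at hD hDuv'
  obtain ⟨i, hi0, hi1⟩ := hDu'.resolve_left (by omega)
  obtain ⟨j, hj0, hj1⟩ := hDv'.resolve_left (by omega)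
  have drop : ∀ (x : (banana n).vertexSet) k,
      profile D k - 1 ≤ profile (D - point (banana n) x) k ∧
        profile (D - point (banana n) x) k ≤ profile D k := by
    intro x k
    have h1 := le_profile_sub hn D (point_nonneg (banana n) x) k
    rw [degree_point] at h1
    exact ⟨h1, profile_sub_le hn D (point_nonneg (banana n) x) k⟩
  have hu1 := drop u i
  have hu2 := drop u (i - 1)
  have hv1 := drop v j
  have hv2 := drop v (j - 1)
  rw [← hDu] at hu1 hu2
  rw [← hDv] at hv1 hv2
  -- Jumps at different indices would, by monotonicity, force deg D > r + g.
  obtain rfl : i = j := by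
    rcases lt_trichotomy i j with h | h | h
    · have := profile_mono hn D (show i ≤ j - 1 by omega)
      omega
    · exact h
    · have := profile_mono hn D (show j ≤ i - 1 by omega)
      omega
  have c1 := hu D i
  have c2 := hv D i
  have c3 := huv D i
  have c4 := huv D (i - 1)
  rw [← hDu] at c1
  rw [← hDv] at c2
  rw [← hDu, ← hDv, ← hDuv] at c3 c4
  have c5 : ¬ (r + 1 ≤ profile D i ∧ profile D (i - 1) + g + 1 + (r + 1) ≤ degree (banana n) D) :=
    fun h => hD.2 ⟨i, h⟩
  refine hDuv'.2 ⟨i, ?_, ?_⟩ <;> omega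

/-- Removing this vertex lowers the floor only when n_α divides j + m_α, which cannot happen at two
consecutive j since n_α ≥ 2. -/
lemma drop_interior_one_le {α : Fin (g + 1)} (hn : ∀ γ, 1 ≤ n γ) (hα : 2 ≤ n α)
    (D : Divisor (banana n)) (j : ℤ) :
    profile D j - profile (D - point (banana n) (bananaVertex n α 1)) j +
      (profile D (j - 1) - profile (D - point (banana n) (bananaVertex n α 1)) (j - 1)) ≤ 1 := by
  rw [profile_sub_interior hn (by omega), profile_sub_interior hn (by omega)]
  have hpos : (0 : ℤ) < n α := by omega
  have h1 : (j + moment α D) / n α - 1 ≤ (j - 1 + moment α D - (1 : ℕ)) / n α := by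
    rw [Int.le_ediv_iff_mul_le hpos, sub_mul]
    have := Int.ediv_mul_le (j + moment α D) hpos.ne'
    push_cast
    linarith
  rw [show j + moment α D - ((1 : ℕ) : ℤ) = j - 1 + moment α D by push_cast; ring]
  linarith

/-- Removing this vertex fails to lower the floor only when j + m_β ≡ -1 modulo n_β, which cannot
happen at two consecutive j. -/
lemma one_le_drop_interior {β : Fin (g + 1)} (hn : ∀ γ, 1 ≤ n γ) (hβ : 2 ≤ n β)
    (D : Divisor (banana n)) (j : ℤ) :
    1 ≤ profile D j - profile (D - point (banana n) (bananaVertex n β (n β - 1))) j +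
      (profile D (j - 1) -
        profile (D - point (banana n) (bananaVertex n β (n β - 1))) (j - 1)) := by
  rw [profile_sub_interior hn (by omega), profile_sub_interior hn (by omega)]
  have hpos : (0 : ℤ) < n β := by omega
  have h1 : (j - 1 + moment β D - (n β - 1 : ℕ)) / n β = (j + moment β D) / n β - 1 := by
    rw [← Int.sub_mul_ediv_right _ _ hpos.ne']
    congr 1
    push_cast [Nat.cast_sub (hn β)]
    ring
  have h2 : (j + moment β D - (n β - 1 : ℕ)) / n β ≤ (j - 1 + moment β D) / n β := by
    refine Int.ediv_le_ediv hpos ?_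
    push_cast [Nat.cast_sub (hn β)]
    linarith
  rw [h1]
  linarith

lemma isSubmodular_ends (hn : ∀ γ, 1 ≤ n γ) (D : Divisor (banana n)) :
    IsSubmodular (banana n) (leftEnd n) (rightEnd n) D := by
  refine isSubmodular_of_profile hn ?_ ?_ ?_ D <;> intro D j
  · simp [profile_sub_leftEnd]
  · simp [profile_sub_rightEnd]
  · simp [profile_sub_leftEnd, profile_sub_rightEnd]

lemma isSubmodular_leftEnd_interior (hn : ∀ γ, 1 ≤ n γ) {β : Fin (g + 1)} (hβ : 2 ≤ n β)
    (D : Divisor (banana n)) :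
    IsSubmodular (banana n) (leftEnd n) (bananaVertex n β (n β - 1)) D := by
  refine isSubmodular_of_profile hn ?_ (one_le_drop_interior hn hβ) ?_ D <;> intro D j
  · simp [profile_sub_leftEnd]
  · rw [sub_right_comm]
    simp [profile_sub_leftEnd]

lemma isSubmodular_interior_interior (hn : ∀ γ, 1 ≤ n γ) {α β : Fin (g + 1)} (hαβ : α ≠ β)
    (hα : 2 ≤ n α) (hβ : 2 ≤ n β) (D : Divisor (banana n)) :
    IsSubmodular (banana n) (bananaVertex n α 1) (bananaVertex n β (n β - 1)) D := by
  refine isSubmodular_of_profile hn (drop_interior_one_le hn hα) (one_le_drop_interior hn hβ) ?_ D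
  intro D j
  rw [profile_sub_interior hn (by omega) (D - _), profile_sub_interior hn (by omega) D,
    profile_sub_interior hn (by omega) D, moment_sub_interior (by omega), if_neg hαβ.symm, sub_zero]
  ring

end Submodular

/-! ### Decreasing runs: two ends, and two interior neighbours -/

noncomputable section Bounds

variable {g : ℕ} {n : Fin (g + 1) → ℕ} {u v : (banana n).vertexSet}

lemma le_rank_of_profile (hn : ∀ γ, 1 ≤ n γ) {D : Divisor (banana n)} {s : ℤ} (hs : 0 ≤ s)
    (h0 : s ≤ profile D 0) (h1 : profile D (-1) + g + 1 + s ≤ degree (banana n) D) :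
    s ≤ rank (banana n) D :=
  (le_rank_iff hn D hs).2 (Or.inr ⟨0, h0, h1⟩)

/-- A single value P(i) excludes all jumps of size s: indices j ≤ i violate the first inequality and
indices j > i the second, by monotonicity. -/
lemma rank_lt_of_profile (hn : ∀ γ, 1 ≤ n γ) {D : Divisor (banana n)} {s : ℤ} (hs : 0 ≤ s) (i : ℤ)
    (hd : degree (banana n) D < s + g) (h0 : profile D i < s)
    (h1 : degree (banana n) D < profile D i + g + 1 + s) : rank (banana n) D < s := by
  by_contra hlt
  rcases (le_rank_iff hn D hs).1 (not_lt.1 hlt) with h | ⟨j, hj0, hj1⟩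
  · omega
  · rcases le_or_gt j i with h | h
    · have := profile_mono hn D h
      omega
    · have := profile_mono hn D (show i ≤ j - 1 by omega)
      omega

/-- The profile at `0` and at `-1` of a divisor with vanishing moments outside two strands. -/
lemma profile_zero_eq {D : Divisor (banana n)} {α β : Fin (g + 1)} (hαβ : α ≠ β)
    (h : ∀ γ, γ ≠ α → γ ≠ β → moment γ D = 0) :
    profile D 0 = D (rightEnd n) + moment α D / n α + moment β D / n β := by
  have key : ∀ γ, (0 + moment γ D) / (n γ : ℤ) =
      (if γ = α then moment α D / (n α : ℤ) else 0) +
        (if γ = β then moment β D / (n β : ℤ) else 0) := by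
    intro γ
    by_cases h1 : γ = α
    · subst h1
      simp [hαβ]
    · by_cases h2 : γ = β
      · subst h2
        simp [h1]
      · simp [h1, h2, h γ h1 h2]
  simp only [profile, key, Finset.sum_add_distrib]
  rw [Finset.sum_ite_eq' Finset.univ α, Finset.sum_ite_eq' Finset.univ β]
  simp [add_assoc]

lemma profile_neg_one_eq (hn : ∀ γ, 1 ≤ n γ) {D : Divisor (banana n)} {α β : Fin (g + 1)}
    (hαβ : α ≠ β) (h : ∀ γ, γ ≠ α → γ ≠ β → moment γ D = 0) :
    profile D (-1) = D (rightEnd n) + (moment α D - 1) / n α + (moment β D - 1) / n β - g + 1 := by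
  have hneg : ∀ γ, (-1 : ℤ) / n γ = -1 := fun γ =>
    Int.ediv_eq_neg_one_of_neg_of_le (by omega) (by have := hn γ; omega)
  have key : ∀ γ, (-1 + moment γ D) / (n γ : ℤ) =
      -1 + (if γ = α then (moment α D - 1) / (n α : ℤ) + 1 else 0) +
        (if γ = β then (moment β D - 1) / (n β : ℤ) + 1 else 0) := by
    intro γ
    by_cases h1 : γ = α
    · subst h1
      simp [hαβ, neg_add_eq_sub]
    · by_cases h2 : γ = β
      · subst h2
        simp [h1, neg_add_eq_sub]
      · simp [h1, h2, h γ h1 h2, hneg]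
  simp only [profile, key, Finset.sum_add_distrib]
  rw [Finset.sum_ite_eq' Finset.univ α, Finset.sum_ite_eq' Finset.univ β]
  simp
  ring

variable (u v) in
/-- The rank of `a u + b v`. -/
def rankAt (a b : ℤ) : ℤ := rank (banana n) (a • point (banana n) u + b • point (banana n) v)

lemma delta_eq_rankAt (a b : ℤ) :
    delta (banana n) u v (a • point (banana n) u + b • point (banana n) v) =
      rankAt u v a b - rankAt u v (a - 1) b - rankAt u v a (b - 1) + rankAt u v (a - 1) (b - 1) := by
  simp only [delta, rankAt, sub_smul, one_smul]
  congr 1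
  · congr 1
    · congr 2
      abel
    · congr 1
      abel
  · congr 1
    abel

/-- Since Δ takes only the values 0 and 1, positivity suffices. The argument is -b because
transmission permutations are indexed by subtracting copies of v. -/
lemma IsTransmissionPerm.apply_neg_eq {τ : Equiv.Perm ℤ}
    (hτ : IsTransmissionPerm (banana n) u v 0 τ) {a b : ℤ}
    (h : 0 < rankAt u v a b - rankAt u v (a - 1) b - rankAt u v a (b - 1) +
      rankAt u v (a - 1) (b - 1)) : τ (-b) = a := by
  have h1 := hτ a (-b)
  rw [neg_smul, sub_neg_eq_add, zero_add, delta_eq_rankAt] at h1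
  by_contra h2
  rw [if_neg h2] at h1
  omega

lemma card_sigma_range (c : ℕ) :
    ((Finset.range c).sigma fun s => Finset.range s).card = c.choose 2 := by
  simp [Finset.card_sigma, Finset.sum_range_id, Nat.choose_two_right]

/-- A decreasing sequence of values of a transmission permutation. -/
lemma IsTransmissionPerm.choose_two_le_invCount {D : Divisor (banana n)} {τ : Equiv.Perm ℤ}
    (hτ : IsTransmissionPerm (banana n) u v D τ) (lo : ℤ) (c : ℕ)
    (h : ∀ s : ℕ, s < c → τ (-(lo + s)) = lo + s) :
    (c.choose 2 : ℕ∞) ≤ invCount (torsionOrder (banana n) u v) τ := by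
  rw [← card_sigma_range]
  refine card_le_invCount _ (fun i => -(lo + i.1)) (fun i => -(lo + i.2)) ?_ ?_
  · rintro ⟨s, t⟩ hi
    simp only [Finset.mem_sigma, Finset.mem_range] at hi
    simp only
    rw [h s hi.1, h t (by omega)]
    omega
  -- Equivalent arguments have the same τ(x) - x, while τ(-x) = x gives 2x there; so distinct
  -- members of the run are never congruent modulo the torsion order.
  · rintro ⟨s, t⟩ hi ⟨s', t'⟩ hi' heq hk
    simp only [Finset.mem_sigma, Finset.mem_range] at hi hi' heq hk
    have h1 := hτ.apply_add hk (-(lo + s'))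
    rw [h s' hi'.1, show -(lo + (s' : ℤ)) + (-(lo + (s : ℤ)) - -(lo + (s' : ℤ))) = -(lo + s) by ring,
      h s hi.1] at h1
    obtain rfl : s = s' := by omega
    obtain rfl : t = t' := by omega
    rfl

section Ends

lemma profile_ends (a b j : ℤ) :
    profile (a • point (banana n) (leftEnd n) + b • point (banana n) (rightEnd n)) j =
      b + ∑ γ, j / (n γ : ℤ) := by
  simp [profile, moment_add, moment_smul, moment_point, position_leftEnd, position_rightEnd,
    point_leftEnd_apply_rightEnd, point_rightEnd_apply_rightEnd, -zsmul_eq_mul]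

lemma degree_smul_add_smul (a b : ℤ) :
    degree (banana n) (a • point (banana n) u + b • point (banana n) v) = a + b := by
  simp only [degree_add, degree_smul, degree_point, mul_one]

theorem exists_isMaxInversions_ends (hn : ∀ γ, 1 ≤ n γ) :
    ∃ M : ℕ, IsMaxInversions (banana n) (leftEnd n) (rightEnd n) M ∧ (g + 1).choose 2 ≤ M := by
  obtain ⟨τ, hτ⟩ := (isSubmodular_ends hn 0).exists_isTransmissionPerm hn
  refine hτ.exists_isMaxInversions hn (hτ.choose_two_le_invCount 0 (g + 1) fun s hs => ?_)
  have hneg : ∀ γ, (-1 : ℤ) / n γ = -1 := fun γ =>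
    Int.ediv_eq_neg_one_of_neg_of_le (by omega) (by have := hn γ; omega)
  have p0 : ∀ a b : ℤ, profile (a • point (banana n) (leftEnd n) +
      b • point (banana n) (rightEnd n)) 0 = b := fun a b => by
    simp only [profile_ends, Int.zero_ediv, Finset.sum_const_zero, add_zero]
  have p1 : ∀ a b : ℤ, profile (a • point (banana n) (leftEnd n) +
      b • point (banana n) (rightEnd n)) (-1) = b - g - 1 := fun a b => by
    simp only [profile_ends, hneg]
    simp
    ring
  have hs0 : (0 : ℤ) ≤ s := by positivity
  rw [zero_add]
  apply hτ.apply_neg_eq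
  have h1 : (s : ℤ) ≤ rankAt (leftEnd n) (rightEnd n) s s :=
    le_rank_of_profile hn hs0 (by rw [p0]) (by rw [p1, degree_smul_add_smul]; omega)
  have h2 : rankAt (leftEnd n) (rightEnd n) (s - 1) s < s :=
    rank_lt_of_profile hn hs0 (-1) (by rw [degree_smul_add_smul]; omega) (by rw [p1]; omega)
      (by rw [p1, degree_smul_add_smul]; omega)
  have h3 : rankAt (leftEnd n) (rightEnd n) s (s - 1) < s :=
    rank_lt_of_profile hn hs0 0 (by rw [degree_smul_add_smul]; omega) (by rw [p0]; omega)
      (by rw [p0, degree_smul_add_smul]; omega)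
  have h4 : (s : ℤ) - 1 ≤ rankAt (leftEnd n) (rightEnd n) (s - 1) (s - 1) := by
    rcases Nat.eq_zero_or_pos s with rfl | hpos
    · exact neg_one_le_rank hn _
    · exact le_rank_of_profile hn (by omega) (by rw [p0]) (by rw [p1, degree_smul_add_smul]; omega)
  omega

end Ends

section InteriorInterior

variable {α β : Fin (g + 1)}

lemma moment_smul_add_smul {i j : ℕ} (hi : i < n α) (hj : j < n β) (a b : ℤ) (γ : Fin (g + 1)) :
    moment γ (a • point (banana n) (bananaVertex n α i) +
      b • point (banana n) (bananaVertex n β j)) =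
      (if γ = α then a * i else 0) + if γ = β then b * j else 0 := by
  rw [moment_add, moment_smul, moment_smul, moment_point, moment_point, position_bananaVertex,
    position_bananaVertex]
  simp only [hi, hj, and_true, eq_comm (a := γ), mul_ite, mul_zero]

lemma smul_add_smul_apply_rightEnd (hn : ∀ γ, 1 ≤ n γ) {i j : ℕ} (hi : i < n α) (hj : j < n β)
    (a b : ℤ) : (a • point (banana n) (bananaVertex n α i) +
      b • point (banana n) (bananaVertex n β j)) (rightEnd n) = 0 := by
  simp only [Pi.add_apply, Pi.smul_apply, point_apply_rightEnd hn _ hi.le,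
    point_apply_rightEnd hn _ hj.le, if_neg hi.ne, if_neg hj.ne, smul_zero, add_zero]

/-- The run is τ(-x) = x for 2 ≤ x < g. It starts at 2 so that x - 1 ≥ 1, where the formula for
P(-1) holds, and stops below g so that deg - g does not yet give the rank. -/
theorem exists_isMaxInversions_interior_interior (hn : ∀ γ, 1 ≤ n γ) (hg : 2 ≤ g) (hαβ : α ≠ β)
    (hα : g + 1 ≤ n α) (hβ : g + 1 ≤ n β) :
    ∃ M : ℕ, IsMaxInversions (banana n) (bananaVertex n α 1) (bananaVertex n β (n β - 1)) M ∧
      (g - 2).choose 2 ≤ M := by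
  obtain ⟨τ, hτ⟩ := (isSubmodular_interior_interior hn hαβ (by omega) (by omega)
    0).exists_isTransmissionPerm hn
  refine hτ.exists_isMaxInversions hn (hτ.choose_two_le_invCount 2 (g - 2) fun s hs => ?_)
  have hq := smul_add_smul_apply_rightEnd (α := α) (β := β) hn (i := 1) (j := n β - 1)
    (by omega) (by omega)
  have hm := moment_smul_add_smul (n := n) (α := α) (β := β) (i := 1) (j := n β - 1)
    (by omega) (by omega)
  have hoff : ∀ a b : ℤ, ∀ γ, γ ≠ α → γ ≠ β → moment γ (a • point (banana n) (bananaVertex n α 1) +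
      b • point (banana n) (bananaVertex n β (n β - 1))) = 0 := fun a b γ h1 h2 => by
    rw [hm, if_neg h1, if_neg h2, add_zero]
  -- Here b(n_β - 1) - e = (b - 1)n_β + (n_β - b - e); the strand length at least g + 1 makes the
  -- last term a genuine remainder.
  have hdiv : ∀ b e : ℤ, 0 < b + e → b + e ≤ g + 1 → (b * (n β - 1 : ℕ) - e) / n β = b - 1 := by
    intro b e h0 h1
    rw [Int.ediv_eq_iff_of_pos (by omega)]
    push_cast [Nat.cast_sub (hn β)]
    have : (g : ℤ) + 1 ≤ n β := by exact_mod_cast hβ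
    constructor <;> nlinarith
  have p0 : ∀ a b : ℤ, 0 ≤ a → a ≤ g → 1 ≤ b → b ≤ g →
      profile (a • point (banana n) (bananaVertex n α 1) +
        b • point (banana n) (bananaVertex n β (n β - 1))) 0 = b - 1 := by
    intro a b ha ha' hb hb'
    rw [profile_zero_eq hαβ (hoff a b), hq, hm, hm, if_pos rfl, if_pos rfl, if_neg hαβ,
      if_neg hαβ.symm, add_zero, zero_add, zero_add]
    have h1 := hdiv b 0 (by omega) (by omega)
    rw [sub_zero] at h1
    rw [h1, Int.ediv_eq_zero_of_lt (by push_cast; omega) (by push_cast; omega), zero_add]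
  have p1 : ∀ a b : ℤ, 1 ≤ a → a ≤ g → 1 ≤ b → b ≤ g →
      profile (a • point (banana n) (bananaVertex n α 1) +
        b • point (banana n) (bananaVertex n β (n β - 1))) (-1) = b - g := by
    intro a b ha ha' hb hb'
    rw [profile_neg_one_eq hn hαβ (hoff a b), hq, hm, hm, if_pos rfl, if_pos rfl, if_neg hαβ,
      if_neg hαβ.symm, add_zero, zero_add, zero_add, hdiv b 1 (by omega) (by omega),
      Int.ediv_eq_zero_of_lt (by push_cast; omega) (by push_cast; omega)]
    ring
  apply hτ.apply_neg_eq
  have h1 : (s : ℤ) + 1 ≤ rankAt (bananaVertex n α 1) (bananaVertex n β (n β - 1)) (2 + s) (2 + s) :=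
    le_rank_of_profile hn (by omega) (by rw [p0] <;> omega)
      (by rw [p1, degree_smul_add_smul] <;> omega)
  have h2 : rankAt (bananaVertex n α 1) (bananaVertex n β (n β - 1)) (2 + s - 1) (2 + s) < s + 1 :=
    rank_lt_of_profile hn (by omega) (-1) (by rw [degree_smul_add_smul]; omega)
      (by rw [p1] <;> omega) (by rw [p1, degree_smul_add_smul] <;> omega)
  have h3 : rankAt (bananaVertex n α 1) (bananaVertex n β (n β - 1)) (2 + s) (2 + s - 1) < s + 1 :=
    rank_lt_of_profile hn (by omega) 0 (by rw [degree_smul_add_smul]; omega)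
      (by rw [p0] <;> omega) (by rw [p0, degree_smul_add_smul] <;> omega)
  have h4 : (s : ℤ) ≤
      rankAt (bananaVertex n α 1) (bananaVertex n β (n β - 1)) (2 + s - 1) (2 + s - 1) := by
    exact le_rank_of_profile hn (by omega) (by rw [p0] <;> omega)
      (by rw [p1, degree_smul_add_smul] <;> omega)
  omega

end InteriorInterior

end Bounds

/-! ### Torsion order against genus, and quadratic growth -/

noncomputable section Growth

variable {g : ℕ} {n : Fin (g + 1) → ℕ} {u v : (banana n).vertexSet}

/-- The fractional position of a divisor between the two multivalent vertices. -/
def fraction (D : Divisor (banana n)) : ℚ := D (rightEnd n) + ∑ γ, (moment γ D : ℚ) / n γ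

lemma fraction_point (hn : ∀ γ, 1 ≤ n γ) (α : Fin (g + 1)) {i : ℕ} (hi : i ≤ n α) :
    fraction (point (banana n) (bananaVertex n α i)) = (i : ℚ) / n α := by
  have h0 : (n α : ℚ) ≠ 0 := by have := hn α; positivity
  rw [fraction, point_apply_rightEnd hn α hi]
  simp only [moment_point, position_bananaVertex]
  rcases hi.lt_or_eq with h | rfl
  · rw [if_neg h.ne, Finset.sum_eq_single α]
    · simp [h]
    · intro γ _ hγ
      simp [hγ.symm]
    · simp
  · simp [h0]

/-- With equal values at the two ends, the fractional change of the moments cancels the change at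
the second end exactly. -/
lemma fraction_fire (hn : ∀ γ, 1 ≤ n γ) {f : Divisor (banana n)}
    (hf : f (leftEnd n) = f (rightEnd n)) : fraction (fire (banana n) f) = 0 := by
  rw [fraction, fire_apply_rightEnd hn]
  push_cast
  rw [← Finset.sum_add_distrib]
  refine Finset.sum_eq_zero fun γ _ => ?_
  have h0 : (n γ : ℚ) ≠ 0 := by have := hn γ; positivity
  rw [moment_fire hn, hf]
  push_cast
  field_simp
  ring

/-- If the torsion order is at most the genus then both marked vertices are at the same relative
distance from the first multivalent vertex. -/
theorem mul_eq_mul_of_torsionOrder_le (hn : ∀ γ, 1 ≤ n γ) {α β : Fin (g + 1)} {i j : ℕ}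
    (hi : i ≤ n α) (hj : j ≤ n β)
    (hk : torsionOrder (banana n) (bananaVertex n α i) (bananaVertex n β j) ≤ g) :
    i * n β = j * n α := by
  set k := torsionOrder (banana n) (bananaVertex n α i) (bananaVertex n β j) with hkdef
  have hk0 : 0 < k := torsionOrder_pos hn _ _
  obtain ⟨f, hf⟩ := (smul_sub_mem_principal_iff (banana n) (bananaVertex n α i)
    (bananaVertex n β j) k).2 dvd_rfl
  set A := (k : ℤ) • point (banana n) (bananaVertex n α i) with hA
  set B := (k : ℤ) • point (banana n) (bananaVertex n β j) with hB
  have hA0 : 0 ≤ A := smul_nonneg (by omega) (point_nonneg _ _)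
  have hB0 : 0 ≤ B := smul_nonneg (by omega) (point_nonneg _ _)
  have hdA : degree (banana n) A = k := by rw [degree_smul, degree_point, mul_one]
  have hdB : degree (banana n) B = k := by rw [degree_smul, degree_point, mul_one]
  have hAB : A = B + fire (banana n) f := by rw [hf, smul_sub]; abel
  have a0 := profile_nonneg_of_nonneg hA0
  have a1 := profile_neg_one_le_of_nonneg hn hA0
  have b0 := profile_nonneg_of_nonneg hB0
  have b1 := profile_neg_one_le_of_nonneg hn hB0
  rw [hAB, profile_add_fire hn] at a0
  rw [hdA, hAB, profile_add_fire hn] at a1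
  rw [hdB] at b1
  -- Both ku and kv are effective of degree k ≤ g, so each profile is nonnegative at 0 and negative
  -- at -1. A monotone function crosses zero once, so the shift relating them vanishes.
  have hδ : f (leftEnd n) = f (rightEnd n) := by
    rcases lt_trichotomy (f (leftEnd n)) (f (rightEnd n)) with h | h | h
    · have := profile_mono hn B (show 0 + (f (leftEnd n) - f (rightEnd n)) ≤ -1 by omega)
      omega
    · exact h
    · have := profile_mono hn B (show 0 ≤ -1 + (f (leftEnd n) - f (rightEnd n)) by omega)
      omega
  have hlin : fraction (fire (banana n) f) = k * ((i : ℚ) / n α - (j : ℚ) / n β) := by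
    rw [hf, ← fraction_point hn α hi, ← fraction_point hn β hj]
    simp only [fraction, moment_smul, moment_sub, Pi.smul_apply, Pi.sub_apply, smul_eq_mul]
    push_cast
    simp only [mul_div_assoc, sub_div, mul_sub, mul_add, ← Finset.mul_sum, Finset.sum_sub_distrib]
    ring
  rw [fraction_fire hn hδ] at hlin
  have hα : (n α : ℚ) ≠ 0 := by have := hn α; positivity
  have hβ : (n β : ℚ) ≠ 0 := by have := hn β; positivity
  have hkq : (k : ℚ) ≠ 0 := by positivity
  have h2 : (i : ℚ) / n α - (j : ℚ) / n β = 0 := by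
    rcases mul_eq_zero.1 hlin.symm with h | h
    · exact absurd h hkq
    · exact h
  rw [sub_eq_zero, div_eq_div_iff hα hβ] at h2
  exact_mod_cast h2

section Chips

variable {α β : Fin (g + 1)}

lemma delta_neg_of_rank {D : Divisor (banana n)}
    (h1 : rank (banana n) D < 1) (h2 : 0 ≤ rank (banana n) (D - point (banana n) u))
    (h3 : 0 ≤ rank (banana n) (D - point (banana n) v))
    (h4 : rank (banana n) (D - point (banana n) u - point (banana n) v) < 0) :
    delta (banana n) u v D < 0 := by
  simp only [delta]
  omega

lemma not_isSubmodular_of_delta_neg {D : Divisor (banana n)} (h : delta (banana n) u v D < 0) :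
    ¬ IsSubmodular (banana n) u v D := by
  intro hD
  have := hD 0 0
  simp only [zero_smul, add_zero] at this
  omega

/-- The ranks involved are at most 0 for u, exactly 0 for the zero divisor (twice), and -1 for -u.
-/
lemma not_isSubmodular_self (hn : ∀ γ, 1 ≤ n γ) (hg : 1 ≤ g) (u : (banana n).vertexSet) :
    ¬ IsSubmodular (banana n) u u (point (banana n) u) := by
  have hlt : ∀ D : Divisor (banana n), degree (banana n) D = 1 → rank (banana n) D < 1 := by
    intro D hD
    by_contra h
    rcases (le_rank_iff hn D (s := 1) (by omega)).1 (by omega) with h | h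
    · omega
    · have := h.two_mul_le hn
      omega
  have h0 : 0 ≤ rank (banana n) (point (banana n) u - point (banana n) u) := by
    rw [sub_self]
    exact le_rank_of_profile hn le_rfl (profile_nonneg_of_nonneg le_rfl)
      (by simpa using profile_neg_one_le_of_nonneg hn (le_refl (0 : Divisor (banana n))))
  refine not_isSubmodular_of_delta_neg (delta_neg_of_rank (hlt _ (degree_point _ _)) h0 h0 ?_)
  rw [rank_of_degree_neg hn]
  · omega
  · rw [degree_sub, degree_sub, degree_point]
    omega

/-- A non-submodular divisor, with one chip at a multivalent vertex and one on each marked strand. -/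
lemma exists_not_isSubmodular_of_two_le (hn : ∀ γ, 1 ≤ n γ) (hg : 3 ≤ g) (hαβ : α ≠ β) {i j : ℕ}
    (hi : 2 ≤ i) (hi' : i < n α) (hj : 2 ≤ j) (hj' : j < n β) :
    ∃ D, ¬ IsSubmodular (banana n) (bananaVertex n α i) (bananaVertex n β j) D := by
  -- On either marked strand the chip at distance 1 and the chip at the second end can slide towards
  -- each other until one reaches the marked vertex. So D-u and D-v are equivalent to effective
  -- divisors, but the single chip at the end cannot serve both strands.
  set D : Divisor (banana n) := point (banana n) (rightEnd n) +
    point (banana n) (bananaVertex n α 1) + point (banana n) (bananaVertex n β 1) with hD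
  have hdeg : degree (banana n) D = 3 := by
    simp only [hD, degree_add, degree_point]
    norm_num
  have hq : D (rightEnd n) = 1 := by
    simp only [hD, Pi.add_apply, point_rightEnd_apply_rightEnd, point_apply_rightEnd hn α (hn α),
      point_apply_rightEnd hn β (hn β)]
    rw [if_neg (by omega), if_neg (by omega)]
    norm_num
  have hm : ∀ γ, moment γ D = (if γ = α then 1 else 0) + if γ = β then 1 else 0 := by
    intro γ
    simp only [hD, moment_add, moment_point, position_rightEnd, position_bananaVertex,
      show 1 < n α by omega, show 1 < n β by omega, and_true, Nat.cast_one, zero_add,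
      eq_comm (a := γ)]
  have hneg : ∀ (γ : Fin (g + 1)) (x : ℤ), x < 0 → -(n γ : ℤ) ≤ x → x / (n γ : ℤ) = -1 :=
    fun γ x h1 h2 => Int.ediv_eq_neg_one_of_neg_of_le h1 (by omega)
  have hzero : ∀ (γ : Fin (g + 1)) (x : ℤ), 0 ≤ x → x < n γ → x / (n γ : ℤ) = 0 :=
    fun γ x h1 h2 => Int.ediv_eq_zero_of_lt h1 h2
  have hmα : moment α D = 1 := by rw [hm, if_pos rfl, if_neg hαβ, add_zero]
  have hmβ : moment β D = 1 := by rw [hm, if_pos rfl, if_neg hαβ.symm, zero_add]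
  have hoff : ∀ γ, γ ≠ α → γ ≠ β → moment γ D = 0 := fun γ h1 h2 => by
    rw [hm, if_neg h1, if_neg h2, add_zero]
  refine ⟨D, not_isSubmodular_of_delta_neg (delta_neg_of_rank ?_ ?_ ?_ ?_)⟩
  · have := profile_neg_one_eq hn hαβ hoff
    rw [hq, hmα, hmβ, sub_self, Int.zero_ediv, Int.zero_ediv] at this
    exact rank_lt_of_profile hn (by omega) (-1) (by omega) (by omega) (by omega)
  · apply le_rank_of_profile hn le_rfl
    · rw [profile_sub_interior hn hi', profile_zero_eq hαβ hoff, hq, hmα, hmβ,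
        hzero α 1 (by omega) (by omega), hzero β 1 (by omega) (by omega),
        hzero α (0 + 1) (by omega) (by omega), hneg α _ (by omega) (by omega)]
      norm_num
    · rw [profile_sub_interior hn hi', profile_neg_one_eq hn hαβ hoff, hq, hmα, hmβ,
        hzero α (1 - 1) (by omega) (by omega), hzero β (1 - 1) (by omega) (by omega),
        hzero α (-1 + 1) (by omega) (by omega), hneg α _ (by omega) (by omega), degree_sub,
        degree_point, hdeg]
      linarith
  · apply le_rank_of_profile hn le_rfl
    · rw [profile_sub_interior hn hj', profile_zero_eq hαβ hoff, hq, hmα, hmβ,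
        hzero α 1 (by omega) (by omega), hzero β 1 (by omega) (by omega),
        hzero β (0 + 1) (by omega) (by omega), hneg β _ (by omega) (by omega)]
      norm_num
    · rw [profile_sub_interior hn hj', profile_neg_one_eq hn hαβ hoff, hq, hmα, hmβ,
        hzero α (1 - 1) (by omega) (by omega), hzero β (1 - 1) (by omega) (by omega),
        hzero β (-1 + 1) (by omega) (by omega), hneg β _ (by omega) (by omega), degree_sub,
        degree_point, hdeg]
      linarith
  · have h0 : profile (D - point (banana n) (bananaVertex n α i) -
        point (banana n) (bananaVertex n β j)) 0 = -1 := by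
      rw [profile_sub_interior hn hj', profile_sub_interior hn hi', moment_sub_interior hi',
        if_neg hαβ.symm, profile_zero_eq hαβ hoff, hq, hmα, hmβ,
        hzero α 1 (by omega) (by omega), hzero β 1 (by omega) (by omega),
        hzero α (0 + 1) (by omega) (by omega), hneg α _ (by omega) (by omega),
        hzero β (0 + (1 - 0)) (by omega) (by omega), hneg β _ (by omega) (by omega)]
      norm_num
    refine rank_lt_of_profile hn le_rfl 0 ?_ (by omega) ?_
    all_goals rw [degree_sub, degree_sub, degree_point, degree_point, hdeg]; omega

/-- The mirror image of `exists_not_isSubmodular_of_two_le` under exchanging the two multivalent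
vertices. -/
lemma exists_not_isSubmodular_of_le_sub_two (hn : ∀ γ, 1 ≤ n γ) (hg : 3 ≤ g) (hαβ : α ≠ β)
    {i j : ℕ} (hi : 1 ≤ i) (hi' : i + 2 ≤ n α) (hj : 1 ≤ j) (hj' : j + 2 ≤ n β) :
    ∃ D, ¬ IsSubmodular (banana n) (bananaVertex n α i) (bananaVertex n β j) D := by
  set D : Divisor (banana n) := point (banana n) (leftEnd n) +
    point (banana n) (bananaVertex n α (n α - 1)) +
    point (banana n) (bananaVertex n β (n β - 1)) with hD
  have hdeg : degree (banana n) D = 3 := by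
    simp only [hD, degree_add, degree_point]
    norm_num
  have hq : D (rightEnd n) = 0 := by
    simp only [hD, Pi.add_apply, point_leftEnd_apply_rightEnd,
      point_apply_rightEnd hn α (show n α - 1 ≤ n α by omega),
      point_apply_rightEnd hn β (show n β - 1 ≤ n β by omega)]
    rw [if_neg (by omega), if_neg (by omega)]
    norm_num
  have hm : ∀ γ, moment γ D = (if γ = α then (n α : ℤ) - 1 else 0) +
      if γ = β then (n β : ℤ) - 1 else 0 := by
    intro γ
    simp only [hD, moment_add, moment_point, position_leftEnd, position_bananaVertex,
      show n α - 1 < n α by omega, show n β - 1 < n β by omega, and_true, zero_add,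
      eq_comm (a := γ), Nat.cast_sub (hn α), Nat.cast_sub (hn β), Nat.cast_one]
  have hzero : ∀ (γ : Fin (g + 1)) (x : ℤ), 0 ≤ x → x < n γ → x / (n γ : ℤ) = 0 :=
    fun γ x h1 h2 => Int.ediv_eq_zero_of_lt h1 h2
  have hmα : moment α D = n α - 1 := by rw [hm, if_pos rfl, if_neg hαβ, add_zero]
  have hmβ : moment β D = n β - 1 := by rw [hm, if_pos rfl, if_neg hαβ.symm, zero_add]
  have hoff : ∀ γ, γ ≠ α → γ ≠ β → moment γ D = 0 := fun γ h1 h2 => by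
    rw [hm, if_neg h1, if_neg h2, add_zero]
  have p0 : profile D 0 = 0 := by
    rw [profile_zero_eq hαβ hoff, hq, hmα, hmβ, hzero α _ (by omega) (by omega),
      hzero β _ (by omega) (by omega)]
    norm_num
  have p1 : profile D (-1) = 1 - g := by
    rw [profile_neg_one_eq hn hαβ hoff, hq, hmα, hmβ, hzero α _ (by omega) (by omega),
      hzero β _ (by omega) (by omega)]
    ring
  refine ⟨D, not_isSubmodular_of_delta_neg (delta_neg_of_rank ?_ ?_ ?_ ?_)⟩
  · exact rank_lt_of_profile hn (by omega) 0 (by omega) (by omega) (by omega)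
  · apply le_rank_of_profile hn le_rfl
    · rw [profile_sub_interior hn (by omega), p0, hmα, hzero α _ (by omega) (by omega),
        hzero α _ (by omega) (by omega)]
      norm_num
    · rw [profile_sub_interior hn (by omega), p1, hmα, hzero α _ (by omega) (by omega),
        hzero α _ (by omega) (by omega), degree_sub, degree_point, hdeg]
      linarith
  · apply le_rank_of_profile hn le_rfl
    · rw [profile_sub_interior hn (by omega), p0, hmβ, hzero β _ (by omega) (by omega),
        hzero β _ (by omega) (by omega)]
      norm_num
    · rw [profile_sub_interior hn (by omega), p1, hmβ, hzero β _ (by omega) (by omega),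
        hzero β _ (by omega) (by omega), degree_sub, degree_point, hdeg]
      linarith
  · have h0 : profile (D - point (banana n) (bananaVertex n α i) -
        point (banana n) (bananaVertex n β j)) (-1) = 1 - g := by
      rw [profile_sub_interior hn (by omega), profile_sub_interior hn (by omega),
        moment_sub_interior (by omega), if_neg hαβ.symm, p1, hmα, hmβ,
        hzero α _ (by omega) (by omega), hzero α _ (by omega) (by omega),
        hzero β _ (by omega) (by omega), hzero β _ (by omega) (by omega)]
      norm_num
    refine rank_lt_of_profile hn le_rfl (-1) ?_ (by omega) ?_
    all_goals rw [degree_sub, degree_sub, degree_point, degree_point, hdeg]; omega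

end Chips

/-- If all divisors are submodular and the marked strands are long, then the torsion order exceeds
the genus. -/
theorem lt_torsionOrder (hn : ∀ γ, 1 ≤ n γ) (hg : 3 ≤ g) {α β : Fin (g + 1)} {i j : ℕ}
    (hi : i ≤ n α) (hj : j ≤ n β)
    (hsub : ∀ D, IsSubmodular (banana n) (bananaVertex n α i) (bananaVertex n β j) D)
    (hα : g + 1 ≤ n α) (hβ : g + 1 ≤ n β) :
    g < torsionOrder (banana n) (bananaVertex n α i) (bananaVertex n β j) := by
  by_contra hk
  have hmul := mul_eq_mul_of_torsionOrder_le hn hi hj (not_lt.1 hk)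
  have hne : bananaVertex n α i ≠ bananaVertex n β j := by
    intro h
    rw [← h] at hsub
    exact not_isSubmodular_self hn (by omega) _ (hsub _)
  rcases Nat.eq_zero_or_pos i with rfl | hi0
  · obtain rfl : j = 0 := by
      rw [zero_mul, eq_comm, mul_eq_zero] at hmul
      omega
    exact hne (by rw [bananaVertex_zero, bananaVertex_zero])
  rcases hi.eq_or_lt with rfl | hi1
  · obtain rfl : j = n β := by
      have : 0 < n α := by omega
      nlinarith
    exact hne (by rw [bananaVertex_last (hn α), bananaVertex_last (hn β)])
  have hj0 : 0 < j := by
    rcases Nat.eq_zero_or_pos j with rfl | h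
    · rw [zero_mul, mul_eq_zero] at hmul
      omega
    · exact h
  have hj1 : j < n β := by
    rcases hj.eq_or_lt with rfl | h
    · rw [mul_comm] at hmul
      have := Nat.eq_of_mul_eq_mul_left hj0 hmul
      omega
    · exact h
  have hαβ : α ≠ β := by
    rintro rfl
    exact hne (by rw [Nat.eq_of_mul_eq_mul_right (by omega) hmul])
  -- Equal relative positions rule out one marked vertex next to the first end with the other next
  -- to the second, as the strands are too long for that.
  have hcases : (2 ≤ i ∧ 2 ≤ j) ∨ (i + 2 ≤ n α ∧ j + 2 ≤ n β) := by
    by_contra! hcon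
    obtain ⟨h1, h2⟩ := hcon
    rcases (show i = 1 ∨ 2 ≤ i by omega) with rfl | hi2
    · have := h2 (by omega)
      nlinarith
    · obtain rfl : j = 1 := by have := h1 hi2; omega
      have h3 : n α < i + 2 := by
        by_contra h
        have := h2 (by omega)
        omega
      nlinarith
  rcases hcases with ⟨h1, h2⟩ | ⟨h1, h2⟩
  · obtain ⟨D, hD⟩ := exists_not_isSubmodular_of_two_le hn hg hαβ h1 hi1 h2 hj1
    exact hD (hsub D)
  · obtain ⟨D, hD⟩ := exists_not_isSubmodular_of_le_sub_two hn hg hαβ hi0 h1 hj0 h2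
    exact hD (hsub D)

/-- Counting the values of a transmission permutation in a quadrant by means of the rank. -/
lemma IsTransmissionPerm.card_filter_le (hn : ∀ γ, 1 ≤ n γ) {D : Divisor (banana n)}
    {τ : Equiv.Perm ℤ} (hτ : IsTransmissionPerm (banana n) u v D τ) (b : ℤ) (N : ℕ) :
    (((Finset.range N).filter fun s : ℕ => τ (b + s) ≤ 0).card : ℤ) =
      rank (banana n) (D - b • point (banana n) v) -
        rank (banana n) (D - (b + N) • point (banana n) v) := by
  induction N with
  | zero => simp
  | succ N ih =>
    have h := hτ.rank_sub_rank hn (b + N) 0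
    simp only [zero_smul, add_zero] at h
    rw [Finset.range_add_one, Finset.filter_insert]
    push_cast
    rw [← add_assoc]
    split_ifs at h ⊢ with h1
    · rw [Finset.card_insert_of_notMem (by simp)]
      push_cast
      linarith
    · linarith

/-- The divisor m(p+q) has large rank for its degree. Counting by ranks turns this into many
nonnegative arguments with nonpositive values and many negative arguments with positive values, all
pairs of which are inversions. -/
theorem exists_isMaxInversions_of_isSubmodular (hn : ∀ γ, 1 ≤ n γ)
    (hsub : ∀ D, IsSubmodular (banana n) u v D) (hk : g < torsionOrder (banana n) u v) :
    ∃ M : ℕ, IsMaxInversions (banana n) u v M ∧ (g / 2 + 1) * (g - g / 2) ≤ M := by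
  set m := g / 2 with hm
  set D : Divisor (banana n) := (m : ℤ) • point (banana n) (leftEnd n) +
    (m : ℤ) • point (banana n) (rightEnd n) with hD
  have hdeg : degree (banana n) D = 2 * m := by
    rw [degree_smul_add_smul]
    ring
  obtain ⟨τ, hτ⟩ := (hsub D).exists_isTransmissionPerm hn
  have hr : (m : ℤ) ≤ rank (banana n) D := by
    refine le_rank_of_profile hn (by omega) ?_ ?_
    · rw [profile_ends]
      simp
    · have hneg : ∀ γ, (-1 : ℤ) / n γ = -1 := fun γ =>
        Int.ediv_eq_neg_one_of_neg_of_le (by omega) (by have := hn γ; omega)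
      rw [profile_ends, hdeg]
      simp only [hneg]
      simp
      linarith
  -- Removing 2m + 1 copies of v makes the degree -1, so this window captures r(D) + 1 arguments.
  set A := (Finset.range (2 * m + 1)).filter fun s : ℕ => τ (0 + s) ≤ 0
  -- Adding 2g copies of v reaches the range where rank = degree - g, so this set has g - 2m + r(D)
  -- elements.
  set B := (Finset.range (2 * g)).filter fun s : ℕ => ¬ τ (-(2 * g : ℕ) + s) ≤ 0
  have hA : m + 1 ≤ A.card := by
    have h1 := hτ.card_filter_le hn 0 (2 * m + 1)
    rw [zero_smul, sub_zero, rank_of_degree_neg hn (D := D - _)] at h1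
    · have : ((m + 1 : ℕ) : ℤ) ≤ A.card := by
        rw [h1]
        push_cast
        linarith
      exact_mod_cast this
    · rw [degree_sub, degree_smul, degree_point, hdeg]
      push_cast
      omega
  have hB : g - m ≤ B.card := by
    have h1 := hτ.card_filter_le hn (-(2 * g : ℕ)) (2 * g)
    rw [neg_add_cancel, zero_smul, sub_zero, rank_of_le_degree hn (D := D - _)] at h1
    · have h2 := Finset.card_filter_add_card_filter_not (s := Finset.range (2 * g))
        (fun s : ℕ => τ (-(2 * g : ℕ) + s) ≤ 0)
      rw [Finset.card_range] at h2
      rw [degree_sub, degree_smul, degree_point, hdeg] at h1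
      push_cast at h1 h2
      have h3 : ((Finset.range (2 * g)).filter fun s : ℕ => τ (-(2 * (g : ℤ)) + s) ≤ 0).card
          + B.card = 2 * g := by
        convert h2 using 2
        simp [B]
      omega
    · rw [degree_sub, degree_smul, degree_point, hdeg]
      push_cast
      omega
  obtain ⟨M, hM, hle⟩ := hτ.exists_isMaxInversions hn (N := (B ×ˢ A).card) <| by
    refine card_le_invCount _ (fun i => -(2 * g : ℕ) + i.1) (fun i => 0 + i.2) ?_ ?_
    · rintro ⟨s, t⟩ hi
      simp only [A, B, Finset.mem_product, Finset.mem_filter, Finset.mem_range] at hi ⊢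
      push_cast at hi ⊢
      omega
    · rintro ⟨s, t⟩ hi ⟨s', t'⟩ hi' heq hdvd
      simp only [A, B, Finset.mem_product, Finset.mem_filter, Finset.mem_range] at hi hi' heq hdvd
      rw [heq] at hdvd
      -- The second entries lie in a window of diameter 2m ≤ g < k.
      have h0 := Int.eq_zero_of_abs_lt_dvd hdvd (by rw [abs_lt]; omega)
      obtain rfl : t = t' := by omega
      obtain rfl : s = s' := by omega
      rfl
  refine ⟨M, hM, le_trans ?_ hle⟩
  rw [Finset.card_product, mul_comm]
  exact Nat.mul_le_mul hB hA

end Growth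

/-! ### One end and the neighbour of the other: values of τ -/

noncomputable section LeftInterior

variable {g : ℕ} {n : Fin (g + 1) → ℕ} {α : Fin (g + 1)}

lemma moment_left_interior (hn : ∀ γ, 1 ≤ n γ) (a b : ℤ) (γ : Fin (g + 1)) :
    moment γ (a • point (banana n) (leftEnd n) +
      b • point (banana n) (bananaVertex n α (n α - 1))) =
      if γ = α then b * ((n α : ℤ) - 1) else 0 := by
  have := hn α
  simp only [moment_add, moment_smul, moment_point, position_leftEnd, position_bananaVertex,
    show n α - 1 < n α by omega, and_true, Nat.cast_sub (hn α), Nat.cast_one, mul_zero, zero_add,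
    eq_comm (a := γ), mul_ite]

lemma left_interior_apply_rightEnd (hn : ∀ γ, 1 ≤ n γ) (a b : ℤ) :
    (a • point (banana n) (leftEnd n) +
      b • point (banana n) (bananaVertex n α (n α - 1))) (rightEnd n) = 0 := by
  have := hn α
  simp only [Pi.add_apply, Pi.smul_apply, point_leftEnd_apply_rightEnd,
    point_apply_rightEnd hn α (show n α - 1 ≤ n α by omega), if_neg (show n α - 1 ≠ n α by omega),
    smul_zero, add_zero]

lemma profile_left_interior_zero (hg : 1 ≤ g) (hn : ∀ γ, 1 ≤ n γ) (a b : ℤ) :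
    profile (a • point (banana n) (leftEnd n) +
      b • point (banana n) (bananaVertex n α (n α - 1))) 0 = b * ((n α : ℤ) - 1) / n α := by
  have : Nontrivial (Fin (g + 1)) := Fin.nontrivial_iff_two_le.2 (by omega)
  obtain ⟨β, hβ⟩ := exists_ne α
  rw [profile_zero_eq hβ.symm fun γ h1 _ => by rw [moment_left_interior hn, if_neg h1],
    moment_left_interior hn, moment_left_interior hn, if_pos rfl, if_neg hβ,
    left_interior_apply_rightEnd hn]
  simp

lemma profile_left_interior_neg_one (hg : 1 ≤ g) (hn : ∀ γ, 1 ≤ n γ) (a b : ℤ) :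
    profile (a • point (banana n) (leftEnd n) +
      b • point (banana n) (bananaVertex n α (n α - 1))) (-1) =
        (b * ((n α : ℤ) - 1) - 1) / n α - g := by
  have : Nontrivial (Fin (g + 1)) := Fin.nontrivial_iff_two_le.2 (by omega)
  obtain ⟨β, hβ⟩ := exists_ne α
  have hneg : (0 - 1 : ℤ) / n β = -1 :=
    Int.ediv_eq_neg_one_of_neg_of_le (by omega) (by have := hn β; omega)
  rw [profile_neg_one_eq hn hβ.symm fun γ h1 _ => by rw [moment_left_interior hn, if_neg h1],
    moment_left_interior hn, moment_left_interior hn, if_pos rfl, if_neg hβ,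
    left_interior_apply_rightEnd hn, hneg]
  ring

/-- A lower bound for the rank of `a u + b v` in terms of two rounded quotients. -/
lemma le_rankAt_left_interior (hg : 1 ≤ g) (hn : ∀ γ, 1 ≤ n γ) {a b A B s : ℤ} (hs : 0 ≤ s)
    (hA : b * ((n α : ℤ) - 1) / n α = A) (hB : (b * ((n α : ℤ) - 1) - 1) / n α = B - 1)
    (h1 : s ≤ A) (h2 : B + s ≤ a + b) :
    s ≤ rankAt (leftEnd n) (bananaVertex n α (n α - 1)) a b := by
  refine le_rank_of_profile hn hs ?_ ?_
  · rwa [profile_left_interior_zero hg hn, hA]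
  · rw [profile_left_interior_neg_one hg hn, hB, degree_smul_add_smul]
    omega

lemma rankAt_left_interior_lt (hg : 1 ≤ g) (hn : ∀ γ, 1 ≤ n γ) {a b A s : ℤ} (hs : 0 ≤ s)
    (hA : b * ((n α : ℤ) - 1) / n α = A) (hd : a + b < s + g) (h1 : A < s)
    (h2 : a + b < A + g + 1 + s) :
    rankAt (leftEnd n) (bananaVertex n α (n α - 1)) a b < s := by
  refine rank_lt_of_profile hn hs 0 ?_ ?_ ?_
  · rwa [degree_smul_add_smul]
  · rwa [profile_left_interior_zero hg hn, hA]
  · rwa [profile_left_interior_zero hg hn, hA, degree_smul_add_smul]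

lemma rankAt_left_interior_lt' (hg : 1 ≤ g) (hn : ∀ γ, 1 ≤ n γ) {a b B s : ℤ} (hs : 0 ≤ s)
    (hB : (b * ((n α : ℤ) - 1) - 1) / n α = B - 1) (hd : a + b < s + g) (h1 : B - 1 - g < s)
    (h2 : a + b < B + s) :
    rankAt (leftEnd n) (bananaVertex n α (n α - 1)) a b < s := by
  refine rank_lt_of_profile hn hs (-1) ?_ ?_ ?_
  · rwa [degree_smul_add_smul]
  · rwa [profile_left_interior_neg_one hg hn, hB]
  · rw [profile_left_interior_neg_one hg hn, hB, degree_smul_add_smul]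
    omega

lemma floor_interior {N y j : ℤ} (hj : 1 ≤ j) (hj' : j ≤ N) :
    (N * y + j) * (N - 1) / N = (N - 1) * y + (j - 1) := by
  rw [Int.ediv_eq_iff_of_pos (by omega)]
  constructor <;> nlinarith

lemma floor_interior_sub_one {N y j : ℤ} (hj : 0 ≤ j) (hj' : j ≤ N - 1) :
    ((N * y + j) * (N - 1) - 1) / N = (N - 1) * y + j - 1 := by
  rw [Int.ediv_eq_iff_of_pos (by omega)]
  constructor <;> nlinarith

variable {τ : Equiv.Perm ℤ}

/-- The transmission permutation at the multiples of the length of the marked strand. -/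
lemma apply_neg_mul (hg : 1 ≤ g) (hn : ∀ γ, 1 ≤ n γ) (hα : 2 ≤ n α)
    (hτ : IsTransmissionPerm (banana n) (leftEnd n) (bananaVertex n α (n α - 1)) 0 τ) {y : ℤ}
    (hy : 0 ≤ y) (hyg : ((n α : ℤ) - 1) * y ≤ g) : τ (-(n α * y)) = -y := by
  -- Since n_α v ~ p + (n_α - 1)q, the divisor -y p + n_α y v is equivalent to (n_α - 1)y q.
  apply hτ.apply_neg_eq
  have hα' : (2 : ℤ) ≤ n α := by exact_mod_cast hα
  have hpos : 0 ≤ ((n α : ℤ) - 1) * y := mul_nonneg (by omega) hy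
  have A0 := floor_interior (N := n α) (y := y - 1) (j := n α) (by omega) le_rfl
  have B0 := floor_interior_sub_one (N := n α) (y := y) (j := 0) le_rfl (by omega)
  have B1 := floor_interior_sub_one (N := n α) (y := y - 1) (j := n α - 1) (by omega) le_rfl
  rw [show (n α : ℤ) * (y - 1) + n α = n α * y by ring] at A0
  rw [add_zero] at B0
  rw [show (n α : ℤ) * (y - 1) + (n α - 1) = n α * y - 1 by ring] at B1
  have h1 : 0 ≤ rankAt (leftEnd n) (bananaVertex n α (n α - 1)) (-y) (n α * y) :=
    le_rankAt_left_interior hg hn le_rfl A0 B0 (by linarith) (by linarith)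
  have h2 : rankAt (leftEnd n) (bananaVertex n α (n α - 1)) (-y - 1) (n α * y) < 0 :=
    rankAt_left_interior_lt' hg hn le_rfl B0 (by linarith) (by linarith) (by linarith)
  have h3 : rankAt (leftEnd n) (bananaVertex n α (n α - 1)) (-y) (n α * y - 1) < 0 :=
    rankAt_left_interior_lt' hg hn le_rfl (B := (n α - 1) * y) (by rw [B1]; ring) (by linarith)
      (by linarith) (by linarith)
  have h4 : -1 ≤ rankAt (leftEnd n) (bananaVertex n α (n α - 1)) (-y - 1) (n α * y - 1) :=
    neg_one_le_rank hn _
  omega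

lemma apply_neg_mul_add_one (hg : 1 ≤ g) (hn : ∀ γ, 1 ≤ n γ) (hα : 2 ≤ n α)
    (hτ : IsTransmissionPerm (banana n) (leftEnd n) (bananaVertex n α (n α - 1)) 0 τ) {y : ℤ}
    (hy : 0 ≤ y) (hyg : ((n α : ℤ) - 1) * y + 1 ≤ g) : τ (-(n α * y + 1)) = g - y := by
  apply hτ.apply_neg_eq
  have hα' : (2 : ℤ) ≤ n α := by exact_mod_cast hα
  have hpos : 0 ≤ ((n α : ℤ) - 1) * y := mul_nonneg (by omega) hy
  have A0 := floor_interior (N := n α) (y := y) (j := 1) le_rfl (by omega)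
  have A1 := floor_interior (N := n α) (y := y - 1) (j := n α) (by omega) le_rfl
  have B1 := floor_interior_sub_one (N := n α) (y := y) (j := 0) le_rfl (by omega)
  rw [show (n α : ℤ) * (y - 1) + n α = n α * y by ring] at A1
  rw [add_zero] at B1
  rw [show (n α : ℤ) * y + 1 - 1 = n α * y by ring]
  have h1 : ((n α : ℤ) - 1) * y + 1 ≤
      rankAt (leftEnd n) (bananaVertex n α (n α - 1)) (g - y) (n α * y + 1) := by
    -- In this residue class the rank is the generic bound degree - g, not the size of a jump.
    refine le_trans ?_ (degree_sub_le_rank hn _)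
    rw [degree_smul_add_smul]
    linarith
  have h2 : rankAt (leftEnd n) (bananaVertex n α (n α - 1)) (g - y - 1) (n α * y + 1) <
      ((n α : ℤ) - 1) * y + 1 :=
    rankAt_left_interior_lt hg hn (by linarith) A0 (by linarith) (by linarith) (by linarith)
  have h3 : rankAt (leftEnd n) (bananaVertex n α (n α - 1)) (g - y) (n α * y) <
      ((n α : ℤ) - 1) * y + 1 :=
    rankAt_left_interior_lt hg hn (by linarith) (A := (n α - 1) * y) (by rw [A1]; ring)
      (by linarith) (by linarith) (by linarith)
  have h4 : ((n α : ℤ) - 1) * y ≤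
      rankAt (leftEnd n) (bananaVertex n α (n α - 1)) (g - y - 1) (n α * y) :=
    le_rankAt_left_interior hg hn hpos A1 B1 (by linarith) (by linarith)
  omega

/-- For the remaining residues the rank is a jump at 0, and the value is the least a that makes both
jump inequalities hold. -/
lemma apply_neg_mul_add (hg : 1 ≤ g) (hn : ∀ γ, 1 ≤ n γ)
    (hτ : IsTransmissionPerm (banana n) (leftEnd n) (bananaVertex n α (n α - 1)) 0 τ) {y j : ℤ}
    (hy : 0 ≤ y) (hj : 2 ≤ j) (hj' : j + 1 ≤ n α) (hyg : ((n α : ℤ) - 1) * y + j ≤ g) :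
    τ (-(n α * y + j)) = ((n α : ℤ) - 2) * y + j - 1 := by
  apply hτ.apply_neg_eq
  have hpos : 0 ≤ ((n α : ℤ) - 1) * y := mul_nonneg (by omega) hy
  have A0 := floor_interior (N := n α) (y := y) (j := j) (by omega) (by omega)
  have B0 := floor_interior_sub_one (N := n α) (y := y) (j := j) (by omega) (by omega)
  have A1 := floor_interior (N := n α) (y := y) (j := j - 1) (by omega) (by omega)
  have B1 := floor_interior_sub_one (N := n α) (y := y) (j := j - 1) (by omega) (by omega)
  rw [← add_sub_assoc] at A1 B1
  have h1 : ((n α : ℤ) - 1) * y + (j - 1) ≤ rankAt (leftEnd n) (bananaVertex n α (n α - 1))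
      ((n α - 2) * y + j - 1) (n α * y + j) :=
    le_rankAt_left_interior hg hn (by linarith) A0 B0 le_rfl (by linarith)
  have h2 : rankAt (leftEnd n) (bananaVertex n α (n α - 1))
      ((n α - 2) * y + j - 1 - 1) (n α * y + j) < ((n α : ℤ) - 1) * y + (j - 1) :=
    rankAt_left_interior_lt' hg hn (by linarith) B0 (by linarith) (by linarith) (by linarith)
  have h3 : rankAt (leftEnd n) (bananaVertex n α (n α - 1))
      ((n α - 2) * y + j - 1) (n α * y + j - 1) < ((n α : ℤ) - 1) * y + (j - 1) :=
    rankAt_left_interior_lt hg hn (by linarith) A1 (by linarith) (by linarith) (by linarith)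
  have h4 : ((n α : ℤ) - 1) * y + (j - 1 - 1) ≤ rankAt (leftEnd n) (bananaVertex n α (n α - 1))
      ((n α - 2) * y + j - 1 - 1) (n α * y + j - 1) :=
    le_rankAt_left_interior hg hn (by linarith) A1 (B := (n α - 1) * y + j - 1)
      (by rw [B1]; ring) le_rfl (by linarith)
  omega

/-- The index of the column attached to the `s`-th slot. -/
def upper (d s : ℕ) : ℤ := s + s / d + 1

/-- The column paired with the `s`-th slot from below. -/
def lower (d s : ℕ) : ℤ := if s % d = 0 then s + s / d else s + s / d + 1

lemma apply_neg_upper (hg : 1 ≤ g) (hn : ∀ γ, 1 ≤ n γ) (hα : 2 ≤ n α)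
    (hτ : IsTransmissionPerm (banana n) (leftEnd n) (bananaVertex n α (n α - 1)) 0 τ) {s : ℕ}
    (hs : s < g) : τ (-upper (n α - 1) s) =
      if s % (n α - 1) = 0 then (g : ℤ) - (s / (n α - 1) : ℕ) else s - (s / (n α - 1) : ℕ) := by
  set d := n α - 1 with hd
  have hnd : (n α : ℤ) = d + 1 := by omega
  have hsd : (d : ℤ) * (s / d : ℕ) + (s % d : ℕ) = s := by exact_mod_cast Nat.div_add_mod s d
  have hlt : s % d < d := Nat.mod_lt _ (by omega)
  split_ifs with h
  · rw [← apply_neg_mul_add_one hg hn hα hτ (y := (s / d : ℕ)) (by positivity)]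
    · congr 2
      rw [hnd, upper]
      rw [h] at hsd
      push_cast at hsd ⊢
      linarith
    · rw [hnd, add_sub_cancel_right]
      omega
  · have := apply_neg_mul_add hg hn hτ (y := (s / d : ℕ)) (j := (s % d : ℕ) + 1) (by positivity)
      (by omega) (by omega) (by rw [hnd, add_sub_cancel_right]; omega)
    rw [show upper d s = n α * (s / d : ℕ) + ((s % d : ℕ) + 1) by
      rw [upper, hnd]
      push_cast at hsd ⊢
      linarith, this, hnd]
    linarith

lemma apply_neg_lower (hg : 1 ≤ g) (hn : ∀ γ, 1 ≤ n γ) (hα : 2 ≤ n α)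
    (hτ : IsTransmissionPerm (banana n) (leftEnd n) (bananaVertex n α (n α - 1)) 0 τ) {s : ℕ}
    (hs : s < g) : τ (-lower (n α - 1) s) =
      if s % (n α - 1) = 0 then -((s / (n α - 1) : ℕ) : ℤ) else s - (s / (n α - 1) : ℕ) := by
  have hup := apply_neg_upper hg hn hα hτ hs
  set d := n α - 1 with hd
  have hnd : (n α : ℤ) = d + 1 := by omega
  have hsd : (d : ℤ) * (s / d : ℕ) + (s % d : ℕ) = s := by exact_mod_cast Nat.div_add_mod s d
  rw [lower]
  split_ifs with h
  · rw [← apply_neg_mul hg hn hα hτ (y := (s / d : ℕ)) (by positivity)]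
    · congr 2
      rw [hnd]
      rw [h] at hsd
      push_cast at hsd ⊢
      linarith
    · rw [hnd, add_sub_cancel_right]
      omega
  · rw [if_neg h] at hup
    exact hup

lemma div_lt_of_lt_of_mod {d s t : ℕ} (hd : 0 < d) (hst : s < t) (ht : t % d = 0) :
    s / d < t / d := by
  rw [Nat.div_lt_iff_lt_mul hd]
  rwa [Nat.div_mul_cancel (Nat.dvd_of_mod_eq_zero ht)]

lemma lower_lt_lower {d s t : ℕ} (hd : 0 < d) (hst : s < t) : lower d s < lower d t := by
  have h1 : s / d ≤ t / d := Nat.div_le_div_right hst.le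
  have h2 := @div_lt_of_lt_of_mod d s t hd hst
  simp only [lower]
  norm_cast
  split_ifs with h3 h4 h4
  · omega
  · omega
  · have := h2 h4
    omega
  · omega

lemma upper_lt_upper {d s t : ℕ} (hst : s < t) : upper d s < upper d t := by
  have h1 : s / d ≤ t / d := Nat.div_le_div_right hst.le
  simp only [upper]
  norm_cast
  omega

/-- The function s - ⌊s/d⌋ increases by one at each step, except when stepping onto a multiple of d,
where it stays constant. The form avoids truncated subtraction. -/
lemma sub_div_lt_sub_div {d s t : ℕ} (hd : 0 < d) (hst : s < t) (ht : t % d ≠ 0) :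
    s + t / d < t + s / d := by
  have h1 := Nat.div_add_mod s d
  have h2 := Nat.div_add_mod t d
  have h3 := Nat.mod_lt s hd
  have h4 : s / d ≤ t / d := Nat.div_le_div_right hst.le
  obtain ⟨e, he⟩ := Nat.exists_eq_add_of_le h4
  rw [he] at h2 ⊢
  rcases Nat.eq_zero_or_pos e with rfl | he0
  · omega
  · have : d * (s / d + e) = d * (s / d) + d * e := by ring
    have h5 : d + e ≤ d * e + 1 := by nlinarith [Nat.mul_le_mul (show 1 ≤ d by omega) he0]
    omega

end LeftInterior

/-! ### One end and the neighbour of the other: counting inversions -/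

noncomputable section LeftInteriorBound

variable {g : ℕ} {n : Fin (g + 1) → ℕ} {α : Fin (g + 1)}

lemma add_div_le_add_div {d s t : ℕ} (hd : 0 < d) (hst : s ≤ t) : s + t / d ≤ t + s / d := by
  obtain ⟨e, rfl⟩ := Nat.exists_eq_add_of_le hst
  have h1 : (s + e) / d ≤ (s + e * d) / d :=
    Nat.div_le_div_right (by nlinarith [Nat.mul_le_mul_left e hd])
  rw [Nat.add_mul_div_right _ _ hd] at h1
  omega

/-- Pairs of slots `s ≤ t`, where `s = t` is allowed only at multiples of `d`. -/
def slotPairs (d g : ℕ) : Finset (Σ _ : ℕ, ℕ) :=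
  (Finset.range g).sigma fun t => (Finset.range (t + 1)).filter fun s => s < t ∨ s % d = 0

/-- Each t < g contributes t pairs, and one more if d divides t; the multiples dy with y < ⌊g/d⌋ all
lie below g. -/
lemma le_card_slotPairs {d : ℕ} (hd : 0 < d) (g : ℕ) :
    g.choose 2 + g / d ≤ (slotPairs d g).card := by
  have h1 : ∀ t, t + (if t % d = 0 then 1 else 0) ≤
      ((Finset.range (t + 1)).filter fun s => s < t ∨ s % d = 0).card := by
    intro t
    have h2 : (Finset.range t).filter (fun s => s < t ∨ s % d = 0) = Finset.range t :=
      Finset.filter_true_of_mem fun s hs => Or.inl (Finset.mem_range.1 hs)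
    rw [Finset.range_add_one, Finset.filter_insert, h2]
    by_cases h : t % d = 0
    · simp [h]
    · simp [h]
  have h3 : g / d ≤ ∑ t ∈ Finset.range g, if t % d = 0 then 1 else 0 := by
    rw [← Finset.card_filter, ← Finset.card_range (g / d),
      ← Finset.card_image_of_injective (Finset.range (g / d)) (mul_right_injective₀ hd.ne')]
    refine Finset.card_le_card fun t ht => ?_
    obtain ⟨y, hy, rfl⟩ := Finset.mem_image.1 ht
    rw [Finset.mem_range] at hy
    refine Finset.mem_filter.2 ⟨Finset.mem_range.2 ?_, Nat.mul_mod_right d y⟩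
    calc d * y < d * (g / d) := Nat.mul_lt_mul_of_pos_left hy hd
      _ ≤ g := Nat.mul_div_le g d
  rw [slotPairs, Finset.card_sigma]
  refine le_trans ?_ (Finset.sum_le_sum fun t _ => h1 t)
  rw [Finset.sum_add_distrib, Finset.sum_range_id, Nat.choose_two_right]
  omega

/-- With d = n_α - 1, a slot s not divisible by d owns one column, of value s - ⌊s/d⌋. A slot s = dy
owns two adjacent columns, of values -y (lower) and g - y (upper). Pairing the upper column of t
with the lower column of s ≤ t always gives an inversion, even for s = t when d divides s. -/
theorem exists_isMaxInversions_left_interior (hn : ∀ γ, 1 ≤ n γ) (hg : 1 ≤ g) (hα : 2 ≤ n α) :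
    ∃ M : ℕ, IsMaxInversions (banana n) (leftEnd n) (bananaVertex n α (n α - 1)) M ∧
      g.choose 2 + g / (n α - 1) ≤ M := by
  obtain ⟨τ, hτ⟩ := (isSubmodular_leftEnd_interior hn hα 0).exists_isTransmissionPerm hn
  have hk : g < torsionOrder (banana n) (leftEnd n) (bananaVertex n α (n α - 1)) := by
    by_contra h
    rw [← bananaVertex_zero n α] at h
    have := mul_eq_mul_of_torsionOrder_le hn (Nat.zero_le _) (Nat.sub_le _ _) (not_lt.1 h)
    rw [zero_mul, eq_comm, mul_eq_zero] at this
    omega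
  have hup := fun s hs => apply_neg_upper hg hn hα hτ (s := s) hs
  have hlow := fun s hs => apply_neg_lower hg hn hα hτ (s := s) hs
  set d := n α - 1 with hd
  have hd0 : 0 < d := by omega
  obtain ⟨M, hM, hle⟩ := hτ.exists_isMaxInversions hn (N := (slotPairs d g).card) <| by
    refine card_le_invCount _ (fun i => -upper d i.1) (fun i => -lower d i.2) ?_ ?_
    · rintro ⟨t, s⟩ hi
      simp only [slotPairs, Finset.mem_sigma, Finset.mem_range, Finset.mem_filter] at hi
      obtain ⟨ht, hst, h⟩ := hi
      have hst' : s ≤ t := by omega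
      have h1 := add_div_le_add_div hd0 hst'
      have h2 := Nat.div_le_self t d
      have h3 := Nat.div_le_div_right (c := d) hst'
      simp only
      refine ⟨?_, ?_⟩
      · simp only [upper, lower]
        norm_cast
        split_ifs <;> omega
      · rw [hup t ht, hlow s (by omega)]
        split_ifs with h4 h5 h5
        · generalize s / d = x at *
          generalize t / d = y at *
          omega
        · have h0 : 0 < t := Nat.pos_of_ne_zero fun h0 => h5 (by rw [h0, Nat.zero_mod])
          have := sub_div_lt_sub_div hd0 h0 h5
          rw [Nat.zero_div] at this
          generalize s / d = x at *
          omega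
        · omega
        · have := sub_div_lt_sub_div hd0 (show s < t by omega) h5
          omega
    · rintro ⟨t, s⟩ hi ⟨t', s'⟩ hi' heq hdvd
      simp only [slotPairs, Finset.mem_sigma, Finset.mem_range, Finset.mem_filter] at hi hi' heq hdvd
      have hb : ∀ t, t < g → 0 ≤ τ (-upper d t) ∧ τ (-upper d t) ≤ g := by
        intro t ht
        have := Nat.div_le_self t d
        rw [hup t ht]
        generalize t / d = y at *
        split_ifs <;> omega
      have h1 := hτ.apply_add hdvd (-upper d t')
      rw [add_sub_cancel] at h1
      have h2 := hb t hi.1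
      have h3 := hb t' hi'.1
      -- Values at upper columns lie in [0, g], and k > g, so two such columns differing by a
      -- multiple of k coincide.
      have h0 := Int.eq_zero_of_abs_lt_dvd hdvd (by rw [abs_lt]; omega)
      obtain rfl : t = t' := by
        rcases lt_trichotomy t t' with h | h | h
        · have := upper_lt_upper (d := d) h
          omega
        · exact h
        · have := upper_lt_upper (d := d) h
          omega
      obtain rfl : s = s' := by
        rcases lt_trichotomy s s' with h | h | h
        · have := lower_lt_lower hd0 h
          omega
        · exact h
        · have := lower_lt_lower hd0 h
          omega
      rfl
  exact ⟨M, hM, (le_card_slotPairs hd0 g).trans hle⟩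

/-- Vandermonde's identity for pairs, with C(f+1, 2) = C(f, 2) + f. -/
lemma choose_two_add (f m : ℕ) :
    (f + 1).choose 2 + f * m + m.choose 2 = (f + m).choose 2 + f := by
  have : (((f + 1).choose 2 + f * m + m.choose 2 : ℕ) : ℚ) = ((f + m).choose 2 + f : ℕ) := by
    push_cast [Nat.cast_choose_two]
    ring
  exact_mod_cast this

/-- The closed form of the bound for a multivalent vertex and the vertex next to the other one. -/
lemma bound_le {N g : ℕ} (hN : 2 ≤ N) :
    (g / (N - 1) + 1).choose 2 + g / (N - 1) *
      (g / (N - 1) * (N - 2) + min (N - 2) (N * g / (N - 1) - N * (g / (N - 1)))) +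
      (g / (N - 1) * (N - 2) + min (N - 2) (N * g / (N - 1) - N * (g / (N - 1)))).choose 2 ≤
      g.choose 2 + g / (N - 1) := by
  obtain ⟨d, rfl⟩ : ∃ d, N = d + 2 := ⟨N - 2, by omega⟩
  rw [show d + 2 - 1 = d + 1 by omega, show d + 2 - 2 = d by omega,
    show (d + 2) * g = g + (d + 1) * g by ring, Nat.add_mul_div_left _ _ (Nat.succ_pos d)]
  set f := g / (d + 1)
  have hf : (d + 1) * f ≤ g := Nat.mul_div_le g (d + 1)
  -- The quantity h is at most g - f: the second entry of the minimum is g - (d+1)f, with no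
  -- truncation because (d+1)f ≤ g.
  have hh : f * d + min d (f + g - (d + 2) * f) ≤ g - f := by
    have h1 : (d + 1) * f = f * d + f := by ring
    have h2 : (d + 2) * f = f * d + f + f := by ring
    have := min_le_right d (f + g - (d + 2) * f)
    omega
  have hfg : f ≤ g := Nat.div_le_self _ _
  calc _ ≤ (f + 1).choose 2 + f * (g - f) + (g - f).choose 2 := by
        gcongr
    _ = g.choose 2 + f := by rw [choose_two_add, Nat.add_sub_cancel' hfg]

end LeftInteriorBound

end ChipFiring

theorem mainTheorem12 :
    -- quadratic growth, with an absolute constant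
    (∃ c : ℝ, 0 < c ∧
      ∀ (g : ℕ) (n : Fin (g + 1) → ℕ) (α β : Fin (g + 1)) (i j : ℕ),
        3 ≤ g → (∀ γ, 1 ≤ n γ) → i ≤ n α → j ≤ n β →
        (∀ D : ChipFiring.Divisor (ChipFiring.banana n),
          ChipFiring.IsSubmodular (ChipFiring.banana n)
            (ChipFiring.bananaVertex n α i) (ChipFiring.bananaVertex n β j) D) →
        g + 1 ≤ n α → g + 1 ≤ n β →
        ∃ M : ℕ,
          ChipFiring.IsMaxInversions (ChipFiring.banana n)
            (ChipFiring.bananaVertex n α i) (ChipFiring.bananaVertex n β j) M ∧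
          c * (g : ℝ) ^ 2 ≤ (M : ℝ)) ∧
    -- explicit bounds
    (∀ (g : ℕ) (n : Fin (g + 1) → ℕ), 2 ≤ g → (∀ γ, 1 ≤ n γ) →
      -- both multivalent vertices are marked
      (∀ α : Fin (g + 1), ∃ M : ℕ,
        ChipFiring.IsMaxInversions (ChipFiring.banana n)
          (ChipFiring.bananaVertex n α 0) (ChipFiring.bananaVertex n α (n α)) M ∧
        (g + 1).choose 2 ≤ M) ∧
      -- a multivalent vertex and the vertex next to the other one are marked
      (∀ α : Fin (g + 1), 2 ≤ n α → ∃ M : ℕ,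
        ChipFiring.IsMaxInversions (ChipFiring.banana n)
          (ChipFiring.bananaVertex n α 0) (ChipFiring.bananaVertex n α (n α - 1)) M ∧
        (let f : ℕ → ℕ := fun x => x / (n α - 1)
         let h : ℕ := f g * (n α - 2) + min (n α - 2) (f (n α * g) - n α * f g)
         (f g + 1).choose 2 + f g * h + h.choose 2 ≤ M)) ∧
      -- neighbours of the two multivalent vertices on two different long strands are marked
      (∀ α β : Fin (g + 1), α ≠ β → g + 1 ≤ n α → g + 1 ≤ n β → ∃ M : ℕ,
        ChipFiring.IsMaxInversions (ChipFiring.banana n)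
          (ChipFiring.bananaVertex n α 1) (ChipFiring.bananaVertex n β (n β - 1)) M ∧
        (g - 2).choose 2 ≤ M)) := by
  open ChipFiring in
  refine ⟨⟨1 / 4, by norm_num, ?_⟩, ?_⟩
  · intro g n α β i j hg hn hi hj hsub hα hβ
    obtain ⟨M, hM, hle⟩ := exists_isMaxInversions_of_isSubmodular hn hsub
      (lt_torsionOrder hn hg hi hj hsub hα hβ)
    refine ⟨M, hM, ?_⟩
    -- With m = ⌊g/2⌋, the product (m+1)(g-m) is m(m+1) or (m+1)² according to the parity of g,
    -- hence at least g²/4; this is the source of the constant.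
    have h1 : g * g ≤ 4 * M := by
      have h2 : 2 * (g / 2) ≤ g := Nat.mul_div_le g 2
      have h3 : g ≤ 2 * (g / 2) + 1 := by omega
      generalize g / 2 = m at hle h2 h3
      obtain ⟨e, rfl⟩ := Nat.exists_eq_add_of_le h2
      rw [show 2 * m + e - m = m + e by omega] at hle
      have : e = 0 ∨ e = 1 := by omega
      rcases this with rfl | rfl <;> nlinarith
    have h2 : (g : ℝ) * g ≤ 4 * M := by exact_mod_cast h1
    linarith [sq (g : ℝ)]
  · intro g n hg hn
    refine ⟨fun α => ?_, fun α hα => ?_, fun α β hαβ hα hβ => ?_⟩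
    · rw [bananaVertex_zero, bananaVertex_last (hn α)]
      exact exists_isMaxInversions_ends hn
    · rw [bananaVertex_zero]
      obtain ⟨M, hM, hle⟩ := exists_isMaxInversions_left_interior hn (by omega) hα
      exact ⟨M, hM, (bound_le hα).trans hle⟩
    · exact exists_isMaxInversions_interior_interior hn hg hαβ hα hβ
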